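/- Let $p$ be an odd prime and let $n,s\ge 0$ be integers, with $s\ge 1$ if $p=3$. Let $\epsilon_0\in\{1,-1\}$ be arbitrary. (1) If $n=4+s$, there exists a pure $p$-ary quantum code with parameters $$\left[\left[\tfrac{p^{n-1}-\epsilon_0p^{n-3}}{2},\ \tfrac{p^{n-1}-\epsilon_0p^{n-3}}{2}-n-2,\ 3\right]\right]_p,$$ and these codes are at least almost optimal according to the quantum Hamming bound. (2) If $n=3+s$, there exists a pure $p$-ary quantum code with parameters $$\left[\left[\tfrac{p^{n-1}+\epsilon_0p^{n-2}}{2},\ \tfrac{p^{n-1}+\epsilon_0p^{n-2}}{2}-n-2,\ 3\right]\right]_p,$$ and these codes are at least almost optimal according to the quantum Hamming bound. Here an $[[N,k,d]]_p$ quantum code is a $p^k$-dimensional subspace $Q$ of $\mathbb{C}^{p^N}$ with minimum distance $d$, the least quantum weight of an error operator $X(a)Z(b)$, $a,b\in\mathbb{F}_p^N$, that $Q$ does not detect in the sense of Knill and Laflamme; it is pure if $\langle v_1|E|v_2\rangle=0$ for all $v_1,v_2\in Q$ and all error operators $E$ of weight between $1$ and $d-1$. "At least almost optimal according to the quantum Hamming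 bound" means: either no quantum code of the same length and dimension has minimum distance at least $d+1$, or an $[[N,k,d+1]]_p$ quantum code exists and no quantum code of the same length and dimension has minimum distance at least $d+2$; moreover the parameters $[[N,k,d+2]]_p$ violate the quantum Hamming bound $p^{N-k}\ge\sum_{j=0}^{\lfloor (d+1)/2\rfloor}\binom Nj(p^2-1)^j$. -/

import Mathlib

open scoped InnerProductSpace

namespace QCode

/-- The Hilbert space of `N` qudits of dimension `p`, of dimension `p ^ N`: its standard
orthonormal basis is indexed by the vectors of `𝔽_p ^ N`. -/
abbrev QSpace (p N : ℕ) [NeZero p] : Type := EuclideanSpace ℂ (Fin N → ZMod p)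

/-- The quantum error operator `X(a) Z(b)`, that is `|x⟩ ↦ ω ^ (b ⬝ x) |x + a⟩` with
`ω = exp (2 π i / p)`. Up to phases `ω ^ l`, which play no role below, these are all the quantum
error operators. -/
noncomputable def errorOp {p N : ℕ} [NeZero p] (a b : Fin N → ZMod p) :
    QSpace p N →ₗ[ℂ] QSpace p N where
  toFun v := WithLp.toLp 2 fun x => ZMod.stdAddChar (b ⬝ᵥ (x - a)) * v (x - a)
  map_add' v w := by
    ext x
    simp [mul_add]
  map_smul' c v := by
    ext x
    simp [mul_left_comm]

/-- The quantum weight of `X(a) Z(b)`: the number of qudits on which it acts nontrivially. -/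
def errorWeight {p N : ℕ} (a b : Fin N → ZMod p) : ℕ :=
  (Finset.univ.filter fun i => a i ≠ 0 ∨ b i ≠ 0).card

/-- `Q` detects the error `X(a) Z(b)` (Knill-Laflamme condition): the matrix elements of the error
between code vectors are a fixed multiple of the inner products. Equivalently, the error never maps
a code vector to a vector that is not orthogonal to a code vector orthogonal to it. -/
def Detects {p N : ℕ} [NeZero p] (Q : Submodule ℂ (QSpace p N)) (a b : Fin N → ZMod p) : Prop :=
  ∃ c : ℂ, ∀ v ∈ Q, ∀ w ∈ Q, ⟪v, errorOp a b w⟫_ℂ = c * ⟪v, w⟫_ℂ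

/-- `Q` has minimum distance `d`: the least weight of an error that `Q` does not detect is `d`. -/
def HasMinDist {p N : ℕ} [NeZero p] (Q : Submodule ℂ (QSpace p N)) (d : ℕ) : Prop :=
  IsLeast {m : ℕ | ∃ a b : Fin N → ZMod p, errorWeight a b = m ∧ ¬ Detects Q a b} d

/-- `Q` is an `[[N, k, d]]_p` quantum code: a `p ^ k`-dimensional subspace of the `p ^ N`-dimensional
Hilbert space, with minimum distance (exactly) `d`. -/
def IsQuantumCode (p N k d : ℕ) [NeZero p] (Q : Submodule ℂ (QSpace p N)) : Prop :=
  Module.finrank ℂ Q = p ^ k ∧ HasMinDist Q d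

/-- `Q`, of minimum distance `d`, is pure: every error of weight between `1` and `d - 1` maps every
code vector to a vector orthogonal to the code. -/
def IsPure {p N : ℕ} [NeZero p] (Q : Submodule ℂ (QSpace p N)) (d : ℕ) : Prop :=
  ∀ a b : Fin N → ZMod p, 1 ≤ errorWeight a b → errorWeight a b ≤ d - 1 →
    ∀ v ∈ Q, ∀ w ∈ Q, ⟪v, errorOp a b w⟫_ℂ = 0

/-- `[[N, k, d]]_p` quantum codes are optimal: no quantum code (pure or not) of the same length and
dimension has a larger minimum distance. -/
def Optimal (p N k d : ℕ) [NeZero p] : Prop :=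
  ¬ ∃ (d' : ℕ) (Q : Submodule ℂ (QSpace p N)), d + 1 ≤ d' ∧ IsQuantumCode p N k d' Q

/-- `[[N, k, d]]_p` quantum codes are almost optimal: there is an optimal `[[N, k, d + 1]]_p`
quantum code. -/
def AlmostOptimal (p N k d : ℕ) [NeZero p] : Prop :=
  (∃ Q : Submodule ℂ (QSpace p N), IsQuantumCode p N k (d + 1) Q) ∧ Optimal p N k (d + 1)

/-- The quantum Hamming bound `p ^ (N - k) ≥ ∑_{j ≤ ⌊(d - 1) / 2⌋} (N choose j) (p² - 1) ^ j` for
the parameters `[[N, k, d]]_p`, multiplied by `p ^ k`. -/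
def HammingBound (p N k d : ℕ) : Prop :=
  p ^ k * ∑ j ∈ Finset.range ((d - 1) / 2 + 1), N.choose j * (p ^ 2 - 1) ^ j ≤ p ^ N

/-- There is a pure `[[N, k, d]]_p` quantum code, and `[[N, k, d]]_p` codes are at least almost
optimal according to the quantum Hamming bound: they are optimal or almost optimal, and already the
parameters `[[N, k, d + 2]]_p` violate the bound. -/
def ExistsGoodPureCode (p N k d : ℕ) [NeZero p] : Prop :=
  (∃ Q : Submodule ℂ (QSpace p N), IsQuantumCode p N k d Q ∧ IsPure Q d) ∧
    (Optimal p N k d ∨ AlmostOptimal p N k d) ∧ ¬ HammingBound p N k (d + 2)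

end QCode

/-! Existence. Put the qudits at the points of a union of parallel `m`-dimensional affine subspaces
of `V = 𝔽_p ^ n`, and let the stabilizer consist of the errors whose X-part is an affine function `x
+ f` and whose Z-part is `y + f ∘ A`, evaluated at the points. These labels form a group of order `p
^ (n + 2)`. It is isotropic because a product of two affine functions has degree at most `2 < (p -
1) m`, hence sums to zero on each subspace (`sum_affine_mul_affine`). If `A` has no eigenvector, an
error of weight one or two cannot commute with the whole group (`exists_stab_dotProduct_ne`): for
weight two it would turn the difference of two points into an eigenvector. This yields purity. Three
points in arithmetic progression carry the word `(1, -2, 1)`, an error of weight three in the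
normalizer, so the distance is exactly three.

Optimality. Distance five is excluded for all codes, degenerate ones included, by linear programming
(`sphereStep_iterate_bound`). The squared moduli of the traces of the errors compressed to the code
satisfy a MacWilliams identity at every detected error. It is paired with the fourth convolution
power of the indicator of the weight one labels: this lives on weights at most `4`, and its Fourier
transform is a fourth power, hence nonnegative. The estimate `LongLength.mul_sphereStep_iterate_lt`
then makes a vanishing sum positive. -/

namespace QCode

open Finset

/-! ### Fourier analysis of radial functions on error labels. -/

section Fourier

variable {p N : ℕ} [NeZero p]

/-- A label of an error operator, as a vector of pairs: the site `i` carries `X(a i) Z(b i)`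
where `(a i, b i)` is the value at `i`. -/
abbrev Label (p N : ℕ) : Type := Fin N → ZMod p × ZMod p

/-- The symplectic character on labels: the commutator phase of two errors. -/
noncomputable def sympChar (E G : Label p N) : ℂ :=
  ZMod.stdAddChar (∑ i, ((E i).1 * (G i).2 - (E i).2 * (G i).1))

lemma sympChar_add_right (E G H : Label p N) :
    sympChar E (G + H) = sympChar E G * sympChar E H := by
  simp only [sympChar, ← AddChar.map_add_eq_mul, ← sum_add_distrib]
  congr 1
  refine sum_congr rfl fun i _ => ?_
  simp only [Pi.add_apply, Prod.fst_add, Prod.snd_add]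
  ring

lemma sympChar_single (E : Label p N) (i : Fin N) (f : ZMod p × ZMod p) :
    sympChar E (Pi.single i f) = ZMod.stdAddChar ((E i).1 * f.2 - (E i).2 * f.1) := by
  rw [sympChar, sum_eq_single i]
  · simp
  · intro j _ hj
    simp [Pi.single_eq_of_ne hj]
  · simp

lemma sum_stdAddChar_mul (x : ZMod p) :
    ∑ y : ZMod p, (ZMod.stdAddChar (y * x) : ℂ) = if x = 0 then (p : ℂ) else 0 := by
  rw [AddChar.sum_mulShift x (ZMod.isPrimitive_stdAddChar p)]
  simp [ZMod.card]

lemma sum_stdAddChar_dotProduct (u : Fin N → ZMod p) :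
    ∑ b : Fin N → ZMod p, (ZMod.stdAddChar (b ⬝ᵥ u) : ℂ) =
      if u = 0 then (p : ℂ) ^ N else 0 := by
  have h : ∀ b : Fin N → ZMod p,
      (ZMod.stdAddChar (b ⬝ᵥ u) : ℂ) = ∏ i, ZMod.stdAddChar (b i * u i) := fun b => by
    rw [dotProduct]
    exact map_prod (ZMod.stdAddChar (N := p)).toMonoidHom (fun i => Multiplicative.ofAdd (b i * u i)) univ
  simp only [h]
  rw [← Fintype.piFinset_univ,
    ← prod_univ_sum (fun _ => univ) (fun i y => (ZMod.stdAddChar (y * u i) : ℂ))]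
  simp only [sum_stdAddChar_mul]
  split_ifs with hu
  · simp [hu]
  · obtain ⟨i, hi⟩ := Function.ne_iff.1 hu
    exact prod_eq_zero (mem_univ i) (if_neg hi)

lemma sum_sympChar_single (E : Label p N) (i : Fin N) :
    ∑ f ∈ univ.erase (0 : ZMod p × ZMod p), sympChar E (Pi.single i f) =
      (if E i = 0 then (p : ℂ) ^ 2 else 0) - 1 := by
  rw [sum_erase_eq_sub (mem_univ _)]
  simp only [sympChar_single]
  congr 1
  · rw [Fintype.sum_prod_type]
    have h : ∀ x y : ZMod p, (ZMod.stdAddChar ((E i).1 * y - (E i).2 * x) : ℂ) =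
        ZMod.stdAddChar (x * -(E i).2) * ZMod.stdAddChar (y * (E i).1) := fun x y => by
      rw [← AddChar.map_add_eq_mul]
      congr 1
      ring
    simp only [h, ← mul_sum, ← sum_mul, sum_stdAddChar_mul, neg_eq_zero]
    by_cases h1 : (E i).1 = 0 <;> by_cases h2 : (E i).2 = 0 <;>
      simp [h1, h2, Prod.ext_iff, sq]
  · simp

/-- With `q = p ^ 2`, a site where `E` vanishes contributes `q - 1` and any other site `-1`. The
result is the degree one Krawtchouk polynomial at the weight of `E`. -/
lemma sum_sum_sympChar_single (E : Label p N) :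
    ∑ i, ∑ f ∈ univ.erase (0 : ZMod p × ZMod p), sympChar E (Pi.single i f) =
      ((p : ℂ) ^ 2 - 1) * N - p ^ 2 * hammingNorm E := by
  simp only [sum_sympChar_single, sum_sub_distrib]
  have h : (N : ℂ) = #{i | E i = 0} + hammingNorm E := by
    rw [hammingNorm, ← Nat.cast_add, card_filter_add_card_filter_not]
    simp
  rw [← sum_filter, sum_const, sum_const, card_univ, Fintype.card_fin, nsmul_eq_mul,
    nsmul_eq_mul]
  rw [eq_sub_of_add_eq h.symm]
  ring

/-- The action on radial functions of convolution with the indicator of the weight one labels. -/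
def sphereStep (q N : ℝ) (h : ℕ → ℝ) (i : ℕ) : ℝ :=
  i * h (i - 1) + i * (q - 2) * h i + (N - i) * (q - 1) * h (i + 1)

omit [NeZero p] in
lemma hammingNorm_add_single_of_eq_zero {G : Label p N} {i : Fin N} (hG : G i = 0)
    {f : ZMod p × ZMod p} (hf : f ≠ 0) :
    hammingNorm (G + Pi.single i f) = hammingNorm G + 1 := by
  have h : (univ.filter fun j => (G + Pi.single i f : Label p N) j ≠ 0) =
      insert i (univ.filter fun j => G j ≠ 0) := by
    ext j
    rcases eq_or_ne j i with rfl | hj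
    · simp [hG, hf]
    · simp [hj]
  rw [hammingNorm, h, card_insert_of_notMem (by simp [hG]), hammingNorm]

omit [NeZero p] in
lemma hammingNorm_add_single_of_ne {G : Label p N} {i : Fin N} (hG : G i ≠ 0)
    {f : ZMod p × ZMod p} (hf : G i + f ≠ 0) :
    hammingNorm (G + Pi.single i f) = hammingNorm G := by
  unfold hammingNorm
  congr 1
  ext j
  rcases eq_or_ne j i with rfl | hj
  · simp [hG, hf]
  · simp [Pi.single_eq_of_ne hj]

omit [NeZero p] in
lemma hammingNorm_add_single_neg {G : Label p N} {i : Fin N} (hG : G i ≠ 0) :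
    hammingNorm (G + Pi.single i (-G i)) = hammingNorm G - 1 := by
  have h := hammingNorm_add_single_of_eq_zero (G := G + Pi.single i (-G i)) (i := i)
    (by simp) hG
  rw [add_assoc, ← Pi.single_add, neg_add_cancel, Pi.single_zero, add_zero] at h
  omega

/-- Count the neighbours of a label of weight `i`: `i` of weight `i - 1`, `i (q - 2)` of weight `i`,
and `(N - i) (q - 1)` of weight `i + 1`, where `q = p ^ 2`. The truncated `i - 1` at `i = 0` is
harmless, its coefficient being zero. -/
lemma sum_radial_add_single (h : ℕ → ℝ) (G : Label p N) :
    ∑ i, ∑ f ∈ univ.erase (0 : ZMod p × ZMod p), h (hammingNorm (G + Pi.single i f)) =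
      sphereStep ((p : ℝ) ^ 2) N h (hammingNorm G) := by
  have hcard : (#(univ.erase (0 : ZMod p × ZMod p)) : ℝ) = (p : ℝ) ^ 2 - 1 := by
    rw [cast_card_erase_of_mem (mem_univ _), card_univ, Fintype.card_prod, ZMod.card]
    push_cast
    ring
  have hi : ∀ i, ∑ f ∈ univ.erase (0 : ZMod p × ZMod p), h (hammingNorm (G + Pi.single i f)) =
      if G i = 0 then ((p : ℝ) ^ 2 - 1) * h (hammingNorm G + 1)
      else h (hammingNorm G - 1) + ((p : ℝ) ^ 2 - 2) * h (hammingNorm G) := by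
    intro i
    split_ifs with hG
    · rw [sum_congr rfl fun f hf => by
        rw [hammingNorm_add_single_of_eq_zero hG (ne_of_mem_erase hf)], sum_const,
        nsmul_eq_mul, hcard]
    · have hm : -G i ∈ univ.erase (0 : ZMod p × ZMod p) := by simp [hG]
      rw [← add_sum_erase _ _ hm, hammingNorm_add_single_neg hG]
      rw [sum_congr rfl fun f hf => by
        rw [hammingNorm_add_single_of_ne hG fun h0 =>
          ne_of_mem_erase hf (eq_neg_of_add_eq_zero_right h0)], sum_const, nsmul_eq_mul,
        cast_card_erase_of_mem hm, hcard]
      ring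
  simp only [hi]
  have hN : (N : ℝ) = #{i | G i = 0} + hammingNorm G := by
    rw [hammingNorm, ← Nat.cast_add, card_filter_add_card_filter_not]
    simp
  rw [sum_ite, sum_const, sum_const, nsmul_eq_mul, nsmul_eq_mul, sphereStep, hN]
  simp only [hammingNorm]
  ring

/-- The Fourier transform turns convolution with the weight one labels into multiplication by the
transform of their indicator. -/
lemma sum_sympChar_mul_sphereStep (h : ℕ → ℝ) (E : Label p N) :
    ∑ G, sympChar E G * (sphereStep ((p : ℝ) ^ 2) N h (hammingNorm G) : ℝ) =
      (((p : ℂ) ^ 2 - 1) * N - p ^ 2 * hammingNorm E) *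
        ∑ G, sympChar E G * (h (hammingNorm G) : ℝ) := by
  simp only [← sum_radial_add_single, Complex.ofReal_sum]
  have key : ∀ (i : Fin N) (f : ZMod p × ZMod p),
      ∑ G : Label p N, sympChar E G * ((h (hammingNorm (G + Pi.single i f)) : ℝ) : ℂ) =
        sympChar E (Pi.single i (-f)) * ∑ G, sympChar E G * ((h (hammingNorm G) : ℝ) : ℂ) := by
    intro i f
    rw [mul_sum]
    refine Fintype.sum_equiv (Equiv.addRight (Pi.single i f)) _ _ fun G => ?_
    rw [Equiv.coe_addRight, ← mul_assoc, ← sympChar_add_right, add_comm _ (G + _), add_assoc,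
      ← Pi.single_add, add_neg_cancel, Pi.single_zero, add_zero]
  calc _ = ∑ i, ∑ f ∈ univ.erase (0 : ZMod p × ZMod p),
        ∑ G : Label p N, sympChar E G * ((h (hammingNorm (G + Pi.single i f)) : ℝ) : ℂ) := by
        simp only [mul_sum]
        rw [sum_comm]
        exact sum_congr rfl fun i _ => sum_comm
    _ = _ := by
        simp only [key]
        rw [← sum_sum_sympChar_single, sum_mul]
        refine sum_congr rfl fun i _ => ?_
        rw [sum_mul]
        exact sum_equiv (Equiv.neg _) (by simp) (by simp)

lemma sum_sympChar_mul_iterate (k : ℕ) (E : Label p N) :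
    ∑ G, sympChar E G *
      (((sphereStep ((p : ℝ) ^ 2) N)^[k] (Pi.single 0 1) (hammingNorm G) : ℝ) : ℂ) =
      (((p : ℂ) ^ 2 - 1) * N - p ^ 2 * hammingNorm E) ^ k := by
  induction k with
  | zero =>
    rw [Fintype.sum_eq_single (0 : Label p N)]
    · simp [sympChar]
    · intro G hG
      simp [Pi.single_eq_of_ne (hammingNorm_ne_zero_iff.2 hG)]
  | succ k ih => rw [Function.iterate_succ_apply', sum_sympChar_mul_sphereStep, ih, pow_succ' _ k]

end Fourier

/-! ### Error operators as an orthogonal basis, and the linear programming identity. -/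

section Weyl

variable {p N : ℕ} [NeZero p]

lemma inner_errorOp (a b : Fin N → ZMod p) (v w : QSpace p N) :
    ⟪v, errorOp a b w⟫_ℂ =
      ∑ x, star (v x) * (ZMod.stdAddChar (b ⬝ᵥ (x - a)) * w (x - a)) := by
  rw [PiLp.inner_apply]
  exact sum_congr rfl fun x _ => mul_comm _ _

lemma star_stdAddChar (x : ZMod p) :
    star (ZMod.stdAddChar x : ℂ) = ZMod.stdAddChar (-x) :=
  (AddChar.map_neg_eq_conj _ _).symm

/-- Orthogonality of the error operators: the Fourier transform of a product of two matrix
coefficients. -/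
lemma sum_mul_inner_errorOp (v w v' w' : QSpace p N) (c d : Fin N → ZMod p) :
    ∑ a : Fin N → ZMod p, ∑ b : Fin N → ZMod p, (ZMod.stdAddChar (a ⬝ᵥ d - b ⬝ᵥ c) : ℂ) *
        (⟪v, errorOp a b w⟫_ℂ * star ⟪v', errorOp a b w'⟫_ℂ) =
      (p : ℂ) ^ N * (⟪v, errorOp c d v'⟫_ℂ * star ⟪w, errorOp c d w'⟫_ℂ) := by
  have h1 : ∀ a b : Fin N → ZMod p, (ZMod.stdAddChar (a ⬝ᵥ d - b ⬝ᵥ c) : ℂ) *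
        (⟪v, errorOp a b w⟫_ℂ * star ⟪v', errorOp a b w'⟫_ℂ) =
      ∑ x, ∑ y, (ZMod.stdAddChar (a ⬝ᵥ d) * star (v x) * w (x - a) * v' y * star (w' (y - a))) *
        ZMod.stdAddChar (b ⬝ᵥ (x - c - y)) := by
    intro a b
    rw [inner_errorOp, inner_errorOp, star_sum, sum_mul_sum, mul_sum]
    refine sum_congr rfl fun x _ => ?_
    rw [mul_sum]
    refine sum_congr rfl fun y _ => ?_
    simp only [star_mul', star_star, star_stdAddChar]
    have : (ZMod.stdAddChar (a ⬝ᵥ d - b ⬝ᵥ c) : ℂ) * (ZMod.stdAddChar (b ⬝ᵥ (x - a)) *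
        ZMod.stdAddChar (-(b ⬝ᵥ (y - a)))) =
        ZMod.stdAddChar (a ⬝ᵥ d) * ZMod.stdAddChar (b ⬝ᵥ (x - c - y)) := by
      simp only [← AddChar.map_add_eq_mul]
      congr 1
      simp only [dotProduct_sub]
      ring
    linear_combination (star (v x) * w (x - a) * v' y * star (w' (y - a))) * this
  have h2 : ∀ a : Fin N → ZMod p, ∑ b : Fin N → ZMod p,
      (ZMod.stdAddChar (a ⬝ᵥ d - b ⬝ᵥ c) : ℂ) *
        (⟪v, errorOp a b w⟫_ℂ * star ⟪v', errorOp a b w'⟫_ℂ) =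
      ∑ x, (p : ℂ) ^ N * (ZMod.stdAddChar (a ⬝ᵥ d) * star (v x) * w (x - a) * v' (x - c) *
        star (w' (x - c - a))) := by
    intro a
    simp only [h1]
    rw [sum_comm]
    refine sum_congr rfl fun x _ => ?_
    rw [sum_comm]
    simp only [← mul_sum, sum_stdAddChar_dotProduct, sub_eq_zero (b := (_ : Fin N → ZMod p))]
    rw [Fintype.sum_eq_single (x - c)]
    · simp only [if_true]
      ring
    · intro y hy
      simp [Ne.symm hy]
  simp only [h2]
  rw [sum_comm]
  simp only [← mul_sum]
  congr 1
  rw [inner_errorOp, inner_errorOp, star_sum, sum_mul_sum]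
  refine sum_congr rfl fun x _ => ?_
  refine Fintype.sum_equiv (Equiv.subLeft x) _ _ fun a => ?_
  simp only [Equiv.subLeft_apply, star_mul', star_star, star_stdAddChar]
  have : (ZMod.stdAddChar (a ⬝ᵥ d) : ℂ) =
      ZMod.stdAddChar (d ⬝ᵥ (x - c)) * ZMod.stdAddChar (-(d ⬝ᵥ (x - a - c))) := by
    rw [← AddChar.map_add_eq_mul]
    congr 1
    simp only [dotProduct_sub, dotProduct_comm a d]
    ring
  rw [this, sub_right_comm x c a]
  ring

/-- The error operator with a given label. -/
noncomputable def labelOp (E : Label p N) : QSpace p N →ₗ[ℂ] QSpace p N :=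
  errorOp (fun i => (E i).1) (fun i => (E i).2)

lemma sum_sympChar_mul_inner_labelOp (v w v' w' : QSpace p N) (G : Label p N) :
    ∑ E, sympChar E G * (⟪v, labelOp E w⟫_ℂ * star ⟪v', labelOp E w'⟫_ℂ) =
      (p : ℂ) ^ N * (⟪v, labelOp G v'⟫_ℂ * star ⟪w, labelOp G w'⟫_ℂ) := by
  rw [labelOp, ← sum_mul_inner_errorOp, ← Fintype.sum_prod_type']
  refine Fintype.sum_equiv (Equiv.arrowProdEquivProdArrow _ _ _) _ _ fun E => ?_
  simp [sympChar, labelOp, Equiv.arrowProdEquivProdArrow, dotProduct, sum_sub_distrib]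

omit [NeZero p] in
lemma errorWeight_label (E : Label p N) :
    errorWeight (fun i => (E i).1) (fun i => (E i).2) = hammingNorm E := by
  unfold errorWeight hammingNorm
  congr 1
  ext i
  simp [Prod.ext_iff, imp_iff_not_or]

/-- A linear programming identity for codes detecting all errors of weight less than `5`: `τ E` is
the squared modulus of the trace of the error `E` compressed to the code. -/
lemma sphereStep_iterate_bound {Q : Submodule ℂ (QSpace p N)} {K : ℕ}
    (hK : Module.finrank ℂ Q = K) (hK0 : 0 < K)
    (hdet : ∀ a b : Fin N → ZMod p, errorWeight a b ≤ 4 → Detects Q a b)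
    (hsupp : ∀ i, 5 ≤ i → (sphereStep ((p : ℝ) ^ 2) N)^[4] (Pi.single 0 1) i = 0) :
    ∃ τ : Label p N → ℝ, (∀ E, 0 ≤ τ E) ∧ 0 < τ 0 ∧
      ∑ E, τ E * (K * (((p : ℝ) ^ 2 - 1) * N - p ^ 2 * hammingNorm E) ^ 4 -
        p ^ N * (sphereStep ((p : ℝ) ^ 2) N)^[4] (Pi.single 0 1) (hammingNorm E)) = 0 := by
  set B := stdOrthonormalBasis ℂ Q with hB
  set e : Fin (Module.finrank ℂ Q) → QSpace p N := fun i => (B i : QSpace p N) with he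
  have hon : ∀ i j, ⟪e i, e j⟫_ℂ = if i = j then 1 else 0 := fun i j =>
    orthonormal_iff_ite.1 B.orthonormal i j
  set t : Label p N → ℂ := fun E => ∑ i, ⟪e i, labelOp E (e i)⟫_ℂ with ht
  -- MacWilliams identity at a detected error: compressed to the code, `G` is a scalar `c`, so both
  -- `K` times the sum of the squared moduli of its matrix entries and the squared modulus of its
  -- trace equal `K ^ 2 * |c| ^ 2`.
  have hF : ∀ G : Label p N, hammingNorm G ≤ 4 →
      (K : ℂ) * ∑ E, sympChar E G * ((Complex.normSq (t E) : ℝ) : ℂ) =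
        (p : ℂ) ^ N * ((Complex.normSq (t G) : ℝ) : ℂ) := by
    intro G hG
    obtain ⟨c, hc⟩ := hdet (fun i => (G i).1) (fun i => (G i).2) (by rwa [errorWeight_label])
    have hc' : ∀ i j, ⟪e i, labelOp G (e j)⟫_ℂ = if i = j then c else 0 := fun i j => by
      rw [labelOp, hc _ (B i).2 _ (B j).2, hon i j]
      simp
    have htG : t G = K * c := by
      simp [ht, hc', ← hK]
    have hsq : ∀ E, ((Complex.normSq (t E) : ℝ) : ℂ) =
        ∑ i, ∑ j, ⟪e i, labelOp E (e i)⟫_ℂ * star ⟪e j, labelOp E (e j)⟫_ℂ := fun E => by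
      rw [← Complex.mul_conj, ← sum_mul_sum, ← star_sum]
      rfl
    have : ∑ E, sympChar E G * ((Complex.normSq (t E) : ℝ) : ℂ) =
        (p : ℂ) ^ N * (K * (c * star c)) := by
      simp only [hsq, mul_sum]
      rw [sum_comm]
      simp only [sum_comm (s := (univ : Finset (Label p N)))]
      simp only [sum_sympChar_mul_inner_labelOp, hc']
      simp [← hK]
      ring
    rw [this, htG, ← Complex.mul_conj]
    simp only [map_mul, Complex.conj_natCast]
    simp only [Complex.star_def]
    ring
  refine ⟨fun E => Complex.normSq (t E), fun E => Complex.normSq_nonneg _, ?_, ?_⟩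
  · have h0 : t 0 = K := by
      have : ∀ v : QSpace p N, labelOp (0 : Label p N) v = v := fun v => by
        ext x
        simp only [labelOp, errorOp, LinearMap.coe_mk, AddHom.coe_mk]
        have h : (fun i : Fin N => ((0 : Label p N) i).1) = 0 := rfl
        have h' : (fun i : Fin N => ((0 : Label p N) i).2) = 0 := rfl
        rw [h, h']
        simp
      simp only [ht, this, hon]
      simp [hK]
    simp only [h0]
    rw [Complex.normSq_pos]
    exact_mod_cast hK0.ne'
  · set u := (sphereStep ((p : ℝ) ^ 2) N)^[4] (Pi.single 0 1) with hu
    -- Multiplying by `u`, which vanishes above weight `4`, makes the identity valid at every label,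
    -- so it can be summed.
    have hz : ∀ G : Label p N, ((u (hammingNorm G) : ℝ) : ℂ) *
        ((K : ℂ) * ∑ E, sympChar E G * ((Complex.normSq (t E) : ℝ) : ℂ)) =
        ((u (hammingNorm G) : ℝ) : ℂ) * ((p : ℂ) ^ N * ((Complex.normSq (t G) : ℝ) : ℂ)) := by
      intro G
      rcases le_or_gt (hammingNorm G) 4 with h | h
      · rw [hF G h]
      · rw [hsupp _ h]
        simp
    have hs := sum_congr (rfl : (univ : Finset (Label p N)) = univ) fun G _ => hz G
    have hl : ∑ G : Label p N, ((u (hammingNorm G) : ℝ) : ℂ) *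
        ((K : ℂ) * ∑ E, sympChar E G * ((Complex.normSq (t E) : ℝ) : ℂ)) =
        ∑ E : Label p N, ((Complex.normSq (t E) : ℝ) : ℂ) *
          ((K : ℂ) * (((p : ℂ) ^ 2 - 1) * N - p ^ 2 * hammingNorm E) ^ 4) := by
      simp only [← sum_sympChar_mul_iterate, mul_sum]
      rw [sum_comm]
      refine sum_congr rfl fun E _ => sum_congr rfl fun G _ => ?_
      ring
    rw [hl] at hs
    rw [← Complex.ofReal_inj]
    push_cast
    simp only [mul_sub, sum_sub_distrib]
    rw [hs, sub_eq_zero]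
    refine sum_congr rfl fun E _ => ?_
    ring

end Weyl

/-! ### Estimates that exclude distance five. -/

section Numeric

lemma sphereStep_iterate_eq_zero (q N : ℝ) (k : ℕ) {i : ℕ} (hi : k < i) :
    (sphereStep q N)^[k] (Pi.single 0 1) i = 0 := by
  induction k generalizing i with
  | zero => exact Pi.single_eq_of_ne hi.ne' _
  | succ k ih =>
    rw [Function.iterate_succ_apply', sphereStep, ih (by omega), ih (by omega), ih (by omega)]
    simp

lemma sphereStep_iterate_two (q N : ℝ) :
    (sphereStep q N)^[2] (Pi.single 0 1) =
      fun i => if i = 0 then N * (q - 1) else if i = 1 then q - 2 else if i = 2 then 2 else 0 := by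
  ext i
  by_cases hi : 2 < i
  · rw [sphereStep_iterate_eq_zero q N 2 hi]
    simp [show i ≠ 0 by omega, show i ≠ 1 by omega, show i ≠ 2 by omega]
  · interval_cases i <;> simp [sphereStep]

lemma sphereStep_iterate_three (q N : ℝ) :
    (sphereStep q N)^[3] (Pi.single 0 1) =
      fun i => if i = 0 then N * (q - 1) * (q - 2) else
        if i = 1 then N * (q - 1) + (q - 2) ^ 2 + 2 * (N - 1) * (q - 1) else
        if i = 2 then 6 * (q - 2) else if i = 3 then 6 else 0 := by
  ext i
  by_cases hi : 3 < i
  · rw [sphereStep_iterate_eq_zero q N 3 hi]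
    simp [show i ≠ 0 by omega, show i ≠ 1 by omega, show i ≠ 2 by omega, show i ≠ 3 by omega]
  · rw [Function.iterate_succ_apply', sphereStep_iterate_two]
    interval_cases i <;> simp [sphereStep] <;> ring

lemma sphereStep_iterate_four (q N : ℝ) {i : ℕ} (hi : i ≤ 4) :
    (sphereStep q N)^[4] (Pi.single 0 1) i =
      if i = 0 then N * (q - 1) * (N * (q - 1) + (q - 2) ^ 2 + 2 * (N - 1) * (q - 1)) else
      if i = 1 then N * (q - 1) * (q - 2) +
        (q - 2) * (N * (q - 1) + (q - 2) ^ 2 + 2 * (N - 1) * (q - 1)) +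
        (N - 1) * (q - 1) * (6 * (q - 2)) else
      if i = 2 then 2 * (N * (q - 1) + (q - 2) ^ 2 + 2 * (N - 1) * (q - 1)) +
        12 * (q - 2) ^ 2 + 6 * (N - 2) * (q - 1) else
      if i = 3 then 36 * (q - 2) else 24 := by
  rw [Function.iterate_succ_apply', sphereStep_iterate_three]
  interval_cases i <;> simp [sphereStep] <;> ring

/-- Everything is compared with powers of `M = (P ^ 2 - 1) * N`, the eigenvalue at weight zero. The
left side is of order `M ^ 4` with a coefficient below `P - 1 ≥ 4`. -/
lemma mul_sphereStep_iterate_four_lt_of_five_le {P N : ℝ} (hP : 5 ≤ P) (hN : P * (P - 1) ≤ 2 * N)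
    {i : ℕ} (hi : i ≤ 4) :
    2 * P ^ 4 * N * (sphereStep (P ^ 2) N)^[4] (Pi.single 0 1) i <
      (P - 1) * ((P ^ 2 - 1) * N - P ^ 2 * i) ^ 4 := by
  obtain ⟨y, hy⟩ : ∃ y, y = P ^ 2 - 1 := ⟨_, rfl⟩
  obtain ⟨M, hM⟩ : ∃ M, M = y * N := ⟨_, rfl⟩
  have hP2 : P ^ 2 = y + 1 := by rw [hy]; ring
  have hy24 : 24 ≤ y := by nlinarith
  have hN10 : 10 ≤ N := by nlinarith
  have hyN : y ≤ 5 / 2 * N := by nlinarith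
  have hM240 : 240 ≤ M := by nlinarith
  have hyM : 10 * y ≤ M := by nlinarith
  have hyy : y ^ 2 ≤ 5 / 2 * M := by nlinarith
  have hq : (y + 1) ≤ 5 / 48 * M := by linarith
  -- The constant rounds up `2 * (25 / 24) ^ 2 / 10`, from `y + 1 ≤ 25 / 24 * y` and `N ≥ 10`.
  have hqN : 2 * P ^ 4 * N ≤ 218 / 1000 * M ^ 2 := by
    have h1 : P ^ 4 = (y + 1) ^ 2 := by rw [← hP2]; ring
    have h2 : (y + 1) ^ 2 ≤ (25 / 24 * y) ^ 2 := by
      apply pow_le_pow_left₀ <;> linarith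
    have h3 : (y + 1) ^ 2 * N ≤ (25 / 24 * y) ^ 2 * N :=
      mul_le_mul_of_nonneg_right h2 (by linarith)
    have h4 : y ^ 2 * N * 10 ≤ M ^ 2 := by
      rw [hM]
      nlinarith [mul_nonneg (sq_nonneg y) (mul_nonneg (by linarith : (0 : ℝ) ≤ N)
        (by linarith : (0 : ℝ) ≤ N - 10))]
    rw [h1]
    nlinarith
  have hM4 : 0 < M ^ 4 := by positivity
  have h0 : (0 : ℝ) ≤ 2 * P ^ 4 * N := by positivity
  have hprod : ∀ {A c : ℝ}, 0 ≤ c → A ≤ c * M ^ 2 → 2 * P ^ 4 * N * A ≤ 218 / 1000 * c * M ^ 4 :=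
    fun {A c} hc hA => by
      calc 2 * P ^ 4 * N * A ≤ 2 * P ^ 4 * N * (c * M ^ 2) := mul_le_mul_of_nonneg_left hA h0
        _ ≤ 218 / 1000 * M ^ 2 * (c * M ^ 2) := mul_le_mul_of_nonneg_right hqN (by positivity)
        _ = _ := by ring
  rw [sphereStep_iterate_four _ _ hi, hP2]
  have hNM : N * (y + 1 - 1) = M := by rw [hM]; ring
  have ha3 : N * (y + 1 - 1) + (y + 1 - 2) ^ 2 + 2 * (N - 1) * (y + 1 - 1) ≤ 11 / 2 * M := by
    nlinarith
  rcases Nat.eq_zero_or_pos i with rfl | hi0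
  · simp only [if_true]
    refine (hprod (c := 11 / 2) (by norm_num) ?_).trans_lt ?_
    · rw [hNM] at ha3 ⊢
      nlinarith
    · have : (y + 1 - 1) * N - (y + 1) * ((0 : ℕ) : ℝ) = M := by rw [hM]; push_cast; ring
      rw [this]
      nlinarith
  · refine (hprod (c := 5 / 4) (by norm_num) ?_).trans_lt ?_
    · have h1 : (y + 1 - 2) * (N * (y + 1 - 1) + (y + 1 - 2) ^ 2 + 2 * (N - 1) * (y + 1 - 1)) ≤
          (y + 1 - 2) * (11 / 2 * M) := mul_le_mul_of_nonneg_left ha3 (by linarith)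
      have h2 : y * M * 10 ≤ M ^ 2 := by nlinarith
      interval_cases i
      · simp only [one_ne_zero, if_false, if_true]
        nlinarith
      · norm_num
        nlinarith
      · norm_num
        nlinarith
      · norm_num
        nlinarith
    · have h4 : (i : ℝ) ≤ 4 := by exact_mod_cast hi
      -- Since `i ≤ 4`, the loss is at most `4 * (5 / 48) * M = 5 / 12 * M`.
      have hlow : 7 / 12 * M ≤ (y + 1 - 1) * N - (y + 1) * i := by
        nlinarith
      calc 218 / 1000 * (5 / 4) * M ^ 4 < 4 * (7 / 12 * M) ^ 4 := by
            rw [mul_pow]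
            linarith
        _ ≤ (P - 1) * (7 / 12 * M) ^ 4 :=
          mul_le_mul_of_nonneg_right (by linarith) (by positivity)
        _ ≤ _ := mul_le_mul_of_nonneg_left
          (pow_le_pow_left₀ (by linarith) hlow 4) (by linarith)

lemma mul_sphereStep_iterate_four_lt_of_eq_three {N : ℝ} (hN : 9 ≤ N) {i : ℕ} (hi : i ≤ 4) :
    81 * N * (sphereStep 9 N)^[4] (Pi.single 0 1) i < (8 * N - 9 * i) ^ 4 := by
  rw [sphereStep_iterate_four _ _ hi]
  have hp : ∀ c : ℝ, 0 ≤ c → c ^ 4 * 81 * N ^ 2 ≤ (c * N) ^ 4 := fun c hc => by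
    have : 81 ≤ N ^ 2 := by nlinarith
    have h := mul_le_mul_of_nonneg_left this (by positivity : 0 ≤ c ^ 4 * N ^ 2)
    calc c ^ 4 * 81 * N ^ 2 = c ^ 4 * N ^ 2 * 81 := by ring
      _ ≤ c ^ 4 * N ^ 2 * N ^ 2 := h
      _ = (c * N) ^ 4 := by ring
  -- Used below with `c = 8 - i`, which is admissible because `9 ≤ N`.
  have hlow : ∀ c : ℝ, 0 ≤ c → c * N ≤ 8 * N - 9 * i →
      c ^ 4 * 81 * N ^ 2 ≤ (8 * N - 9 * i) ^ 4 := fun c hc h =>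
    (hp c hc).trans (pow_le_pow_left₀ (by positivity) h 4)
  interval_cases i
  · norm_num
    have h1 : 81 * N * (N * 8 * (N * 8 + 49 + 2 * (N - 1) * 8)) =
      N ^ 2 * (648 * (24 * N + 33)) := by ring
    have h2 : (8 * N) ^ 4 = N ^ 2 * (4096 * N ^ 2) := by ring
    rw [h1, h2]
    exact mul_lt_mul_of_pos_left (by nlinarith) (by positivity)
  · refine lt_of_lt_of_le ?_ (hlow 7 (by norm_num) (by push_cast; linarith))
    norm_num
    nlinarith
  · refine lt_of_lt_of_le ?_ (hlow 6 (by norm_num) (by push_cast; linarith))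
    norm_num
    nlinarith
  · refine lt_of_lt_of_le ?_ (hlow 5 (by norm_num) (by push_cast; linarith))
    norm_num
    nlinarith
  · refine lt_of_lt_of_le ?_ (hlow 4 (by norm_num) (by push_cast; linarith))
    norm_num
    nlinarith

/-- Lengths `N` and exponents `n` for which the quantum Hamming bound excludes distance `5`. -/
structure LongLength (p n N : ℕ) : Prop where
  size : 5 ≤ p ∧ 3 ≤ n ∨ p = 3 ∧ 4 ≤ n
  le : p ^ (n - 2) * (p - 1) ≤ 2 * N

variable {p n N : ℕ}

/-- The first bound trades `p ^ (n + 2)` for a multiple of `N`, which removes `n` from the later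
inequalities. -/
lemma LongLength.cast_bounds (h : LongLength p n N) :
    (p : ℝ) ^ (n + 2) * (p - 1) ≤ 2 * (p : ℝ) ^ 4 * N ∧
      ((5 : ℝ) ≤ p ∧ (p : ℝ) * (p - 1) ≤ 2 * N ∨ (p : ℝ) = 3 ∧ (9 : ℝ) ≤ N) := by
  have hp1 : 1 ≤ p := by rcases h.size with h | h <;> omega
  have hle : (p : ℝ) ^ (n - 2) * (p - 1) ≤ 2 * N := by
    have := h.le
    rw [← Nat.cast_le (α := ℝ)] at this
    push_cast [hp1] at this
    exact this
  have hp1' : (1 : ℝ) ≤ p := by exact_mod_cast hp1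
  constructor
  · have hn : n + 2 = 4 + (n - 2) := by rcases h.size with h | h <;> omega
    rw [hn, pow_add]
    nlinarith [mul_le_mul_of_nonneg_left hle (by positivity : (0 : ℝ) ≤ (p : ℝ) ^ 4)]
  · rcases h.size with ⟨hp, hn⟩ | ⟨hp, hn⟩
    · refine Or.inl ⟨by exact_mod_cast hp, le_trans ?_ hle⟩
      exact mul_le_mul_of_nonneg_right (le_self_pow₀ hp1' (by omega)) (by linarith)
    · refine Or.inr ⟨by exact_mod_cast hp, ?_⟩
      subst hp
      have : (3 : ℝ) ^ 2 ≤ 3 ^ (n - 2) := pow_le_pow_right₀ (by norm_num) (by omega)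
      push_cast at hle
      linarith

lemma LongLength.mul_sphereStep_iterate_lt (h : LongLength p n N) {i : ℕ} (hi : i ≤ 4) :
    (p : ℝ) ^ (n + 2) * (sphereStep ((p : ℝ) ^ 2) N)^[4] (Pi.single 0 1) i <
      (((p : ℝ) ^ 2 - 1) * N - (p : ℝ) ^ 2 * i) ^ 4 := by
  obtain ⟨hD, h⟩ := h.cast_bounds
  set u := (sphereStep ((p : ℝ) ^ 2) N)^[4] (Pi.single 0 1) i with hu
  have hp1 : (0 : ℝ) < p - 1 := by rcases h with h | h <;> linarith [h.1]
  rcases le_or_gt u 0 with hu0 | hu0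
  · refine lt_of_le_of_lt (mul_nonpos_of_nonneg_of_nonpos (by positivity) hu0) ?_
    refine pow_pos ?_ 4
    have hi' : (i : ℝ) ≤ 4 := by exact_mod_cast hi
    rcases h with ⟨h5, hN⟩ | ⟨h3, hN⟩
    · have h10 : (10 : ℝ) ≤ N := by nlinarith
      have h25 : (25 : ℝ) ≤ (p : ℝ) ^ 2 := by nlinarith
      have h1 : ((p : ℝ) ^ 2 - 1) * 10 ≤ ((p : ℝ) ^ 2 - 1) * N :=
        mul_le_mul_of_nonneg_left h10 (by linarith)
      have h2 : (p : ℝ) ^ 2 * i ≤ (p : ℝ) ^ 2 * 4 :=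
        mul_le_mul_of_nonneg_left hi' (by linarith)
      linarith
    · rw [h3]
      linarith
  · have key : 2 * (p : ℝ) ^ 4 * N * u < (p - 1) * (((p : ℝ) ^ 2 - 1) * N - (p : ℝ) ^ 2 * i) ^ 4 := by
      rcases h with ⟨h5, hN⟩ | ⟨h3, hN⟩
      · exact mul_sphereStep_iterate_four_lt_of_five_le h5 hN hi
      · have := mul_sphereStep_iterate_four_lt_of_eq_three hN hi
        rw [h3, show (3 : ℝ) ^ 2 = 9 by norm_num] at hu
        rw [← hu] at this
        rw [h3]
        norm_num
        linarith
    have h2 := mul_le_mul_of_nonneg_right hD hu0.le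
    refine lt_of_mul_lt_mul_left (lt_of_le_of_lt ?_ key) hp1.le
    linarith

/-- The quadratic term of the sphere volume grows like `N ^ 2`, while `p ^ (n + 2)` is at most
linear in `N`. -/
lemma LongLength.not_hammingBound (h : LongLength p n N) {k : ℕ} (hk : N = k + (n + 2)) :
    ¬ HammingBound p N k 5 := by
  intro hH
  obtain ⟨hD, hc⟩ := h.cast_bounds
  have hp1 : 1 ≤ p := by rcases h.size with h | h <;> omega
  have hN1 : 1 ≤ N := by omega
  rw [HammingBound] at hH
  simp only [show (5 - 1) / 2 + 1 = 3 from rfl, sum_range_succ, range_zero, sum_empty] at hH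
  rw [← Nat.cast_le (α := ℝ)] at hH
  have hp2 : 1 ≤ p ^ 2 := Nat.one_le_pow _ _ hp1
  push_cast [Nat.cast_choose_two, hp2] at hH
  rw [show (p : ℝ) ^ N = (p : ℝ) ^ k * (p : ℝ) ^ (n + 2) by rw [← pow_add, ← hk]] at hH
  have hp0 : (0 : ℝ) < (p : ℝ) ^ k := by positivity
  have hH' := le_of_mul_le_mul_left hH hp0
  simp only [Nat.choose_zero_right, Nat.choose_one_right, Nat.cast_one, pow_zero, pow_one] at hH'
  rcases hc with ⟨h5, hN⟩ | ⟨h3, hN⟩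
  · obtain ⟨y, hy⟩ : ∃ y : ℝ, y = (p : ℝ) ^ 2 - 1 := ⟨_, rfl⟩
    have hP4 : (p : ℝ) ^ 4 = (y + 1) ^ 2 := by rw [hy]; ring
    rw [← hy] at hH'
    have hy24 : 24 ≤ y := by nlinarith
    have hN10 : (10 : ℝ) ≤ N := by nlinarith
    have h1 : (y + 1) ^ 2 ≤ 2 * y ^ 2 := by nlinarith
    have h2 : (p : ℝ) ^ (n + 2) * 4 ≤ 2 * (2 * y ^ 2) * N := by
      have : (p : ℝ) ^ (n + 2) * 4 ≤ (p : ℝ) ^ (n + 2) * (p - 1) :=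
        mul_le_mul_of_nonneg_left (by linarith) (by positivity)
      have := mul_le_mul_of_nonneg_right h1 (by linarith : (0 : ℝ) ≤ N)
      rw [hP4] at hD
      linarith
    have h3 : 9 * (N * y ^ 2) ≤ N * (N - 1) * y ^ 2 := by
      nlinarith [mul_nonneg (mul_nonneg (by linarith : (0 : ℝ) ≤ N)
        (by linarith : (0 : ℝ) ≤ N - 10)) (sq_nonneg y)]
    have h4 : 0 ≤ (N : ℝ) * y ^ 2 := by positivity
    have h5 : 0 ≤ (N : ℝ) * y := by positivity
    linarith
  · rw [h3] at hH' hD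
    norm_num at hH' hD
    nlinarith

/-- Ensures `k ≥ 2`, hence `4 ≤ p ^ k`: room for the four vectors that witness the exact distance.
-/
lemma LongLength.add_four_le (h : LongLength p n N) : n + 4 ≤ N := by
  have h3 : ∀ m : ℕ, 2 ≤ m → m + 6 ≤ 3 ^ m := fun m hm => by
    induction m, hm using Nat.le_induction with
    | base => norm_num
    | succ m hm ih => rw [pow_succ]; omega
  have h5 : ∀ m : ℕ, 1 ≤ m → m + 6 ≤ 2 * 5 ^ m := fun m hm => by
    induction m, hm using Nat.le_induction with
    | base => norm_num
    | succ m hm ih => rw [pow_succ]; omega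
  have hle := h.le
  rcases h.size with ⟨hp, hn⟩ | ⟨rfl, hn⟩
  · have h1 := h5 (n - 2) (by omega)
    have h2 : 5 ^ (n - 2) * 4 ≤ p ^ (n - 2) * (p - 1) :=
      Nat.mul_le_mul (Nat.pow_le_pow_left hp _) (by omega)
    omega
  · have h1 := h3 (n - 2) (by omega)
    omega

/-- No code with these parameters, degenerate or not, has minimum distance at least `5`. -/
theorem LongLength.not_isQuantumCode [NeZero p] (h : LongLength p n N) {k d : ℕ}
    (hk : N = k + (n + 2)) (hd : 5 ≤ d) (Q : Submodule ℂ (QSpace p N)) :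
    ¬ IsQuantumCode p N k d Q := by
  rintro ⟨hfr, -, hmin⟩
  have hp0 : 0 < p := NeZero.pos p
  obtain ⟨τ, hτ, hτ0, hsum⟩ := sphereStep_iterate_bound hfr (pow_pos hp0 k)
    (fun a b hab => by
      by_contra hdet
      have := hmin ⟨a, b, rfl, hdet⟩
      omega)
    (fun i hi => sphereStep_iterate_eq_zero _ _ 4 (by omega))
  have hpow : (p : ℝ) ^ N = (p : ℝ) ^ k * (p : ℝ) ^ (n + 2) := by rw [← pow_add, ← hk]
  have hpk : (0 : ℝ) < (p : ℝ) ^ k := by have : (0 : ℝ) < p := by exact_mod_cast hp0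
                                         positivity
  push_cast at hsum
  simp only [hpow, mul_assoc ((p : ℝ) ^ k), ← mul_sub] at hsum
  have hlt : ∀ E : Label p N, hammingNorm E ≤ 4 →
      0 < (p : ℝ) ^ k * ((((p : ℝ) ^ 2 - 1) * N - p ^ 2 * hammingNorm E) ^ 4 -
        p ^ (n + 2) * (sphereStep ((p : ℝ) ^ 2) N)^[4] (Pi.single 0 1) (hammingNorm E)) :=
    fun E hE => mul_pos hpk (sub_pos.2 (h.mul_sphereStep_iterate_lt hE))
  -- Every term is nonnegative, and the one at the zero label is positive.
  refine hsum.not_gt (sum_pos' (fun E _ => mul_nonneg (hτ E) ?_)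
    ⟨0, mem_univ _, mul_pos hτ0 (hlt 0 (by simp))⟩)
  rcases le_or_gt (hammingNorm E) 4 with hE | hE
  · exact (hlt E hE).le
  · rw [sphereStep_iterate_eq_zero _ _ 4 hE, mul_zero, sub_zero]
    exact mul_nonneg hpk.le (by positivity)

theorem LongLength.optimal_or_almostOptimal [NeZero p] (h : LongLength p n N) {k : ℕ}
    (hk : N = k + (n + 2)) : Optimal p N k 3 ∨ AlmostOptimal p N k 3 := by
  by_cases h4 : ∃ Q : Submodule ℂ (QSpace p N), IsQuantumCode p N k 4 Q
  · exact Or.inr ⟨h4, fun ⟨d, Q, hd, hQ⟩ => h.not_isQuantumCode hk hd Q hQ⟩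
  · refine Or.inl fun ⟨d, Q, hd, hQ⟩ => ?_
    rcases hd.eq_or_lt with rfl | hd
    · exact h4 ⟨Q, hQ⟩
    · exact h.not_isQuantumCode hk hd Q hQ

end Numeric

/-! ### Stabilizer codes: dimension and detection. -/

section Stabilizer

variable {p N : ℕ} [NeZero p]

lemma errorOp_apply (a b : Fin N → ZMod p) (v : QSpace p N) (x : Fin N → ZMod p) :
    errorOp a b v x = ZMod.stdAddChar (b ⬝ᵥ (x - a)) * v (x - a) := rfl

lemma errorOp_errorOp (a b a' b' : Fin N → ZMod p) (v : QSpace p N) :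
    errorOp a b (errorOp a' b' v) =
      (ZMod.stdAddChar (b ⬝ᵥ a') : ℂ) • errorOp (a + a') (b + b') v := by
  ext x
  rw [PiLp.smul_apply, errorOp_apply, errorOp_apply, errorOp_apply, smul_eq_mul, ← mul_assoc,
    ← mul_assoc, ← AddChar.map_add_eq_mul, ← AddChar.map_add_eq_mul, sub_sub]
  congr 2
  simp only [dotProduct_sub, add_dotProduct, dotProduct_add]
  ring

lemma errorOp_comm (a b a' b' : Fin N → ZMod p) (v : QSpace p N) :
    errorOp a b (errorOp a' b' v) =
      (ZMod.stdAddChar (b ⬝ᵥ a' - b' ⬝ᵥ a) : ℂ) • errorOp a' b' (errorOp a b v) := by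
  rw [errorOp_errorOp, errorOp_errorOp, smul_smul, ← AddChar.map_add_eq_mul, sub_add_cancel,
    add_comm a, add_comm b]

lemma errorOp_zero (v : QSpace p N) : errorOp 0 0 v = v := by
  ext x
  simp [errorOp_apply]

lemma star_stdAddChar_mul_self (x : ZMod p) :
    star (ZMod.stdAddChar x : ℂ) * ZMod.stdAddChar x = 1 := by
  rw [star_stdAddChar, ← AddChar.map_add_eq_mul, neg_add_cancel, AddChar.map_zero_eq_one]

lemma inner_errorOp_errorOp (a b : Fin N → ZMod p) (v w : QSpace p N) :
    ⟪errorOp a b v, errorOp a b w⟫_ℂ = ⟪v, w⟫_ℂ := by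
  rw [PiLp.inner_apply, PiLp.inner_apply]
  refine Fintype.sum_equiv (Equiv.subRight a) _ _ fun x => ?_
  rw [errorOp_apply, errorOp_apply]
  simp only [Equiv.subRight_apply, RCLike.inner_apply, map_mul]
  have := star_stdAddChar_mul_self (b ⬝ᵥ (x - a))
  rw [Complex.star_def] at this
  linear_combination (w (x - a) * (starRingEnd ℂ) (v (x - a))) * this

lemma errorOp_ne_zero (a b : Fin N → ZMod p) {v : QSpace p N} (hv : v ≠ 0) :
    errorOp a b v ≠ 0 := by
  rw [← inner_self_ne_zero (𝕜 := ℂ), inner_errorOp_errorOp]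
  exact inner_self_ne_zero.2 hv

lemma trace_errorOp (a b : Fin N → ZMod p) :
    LinearMap.trace ℂ (QSpace p N) (errorOp a b) =
      if a = 0 ∧ b = 0 then (p : ℂ) ^ N else 0 := by
  rw [LinearMap.trace_eq_sum_inner _ (EuclideanSpace.basisFun (Fin N → ZMod p) ℂ)]
  simp only [EuclideanSpace.basisFun_apply, EuclideanSpace.inner_single_left, errorOp_apply,
    map_one, one_mul, PiLp.single_apply]
  by_cases ha : a = 0
  · subst ha
    simp only [sub_zero, if_true, mul_one, true_and, ← sum_stdAddChar_dotProduct]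
    exact sum_congr rfl fun x _ => by rw [dotProduct_comm]
  · simp [ha]

/-- Normalization of the error operators, multiplicative on isotropic groups;
here `c` is half of `1`. -/
noncomputable def weylOp (c : ZMod p) (a b : Fin N → ZMod p) : QSpace p N →ₗ[ℂ] QSpace p N :=
  (ZMod.stdAddChar (c * (a ⬝ᵥ b)) : ℂ) • errorOp a b

lemma trace_weylOp (c : ZMod p) (a b : Fin N → ZMod p) :
    LinearMap.trace ℂ (QSpace p N) (weylOp c a b) =
      if a = 0 ∧ b = 0 then (p : ℂ) ^ N else 0 := by
  rw [weylOp, map_smul, trace_errorOp]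
  split_ifs with h
  · simp [h.1]
  · simp

/-- For commuting errors the two cross terms of `(a + a') ⬝ᵥ (b + b')` agree, so half of their sum
is exactly the phase produced by the composition. -/
lemma weylOp_weylOp {c : ZMod p} (hc : c + c = 1) {a b a' b' : Fin N → ZMod p}
    (h : a ⬝ᵥ b' = b ⬝ᵥ a') (v : QSpace p N) :
    weylOp c a b (weylOp c a' b' v) = weylOp c (a + a') (b + b') v := by
  simp only [weylOp, LinearMap.smul_apply, map_smul, errorOp_errorOp, smul_smul,
    ← AddChar.map_add_eq_mul]
  congr 2
  simp only [dotProduct_add, add_dotProduct, h, dotProduct_comm a' b]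
  linear_combination (-(b ⬝ᵥ a')) * hc

variable {G : Type*} [AddCommGroup G]

/-- The code stabilized by the error operators with labels `(α g, β g)`. -/
noncomputable def stabilizerCode (c : ZMod p) (α β : G →+ (Fin N → ZMod p)) :
    Submodule ℂ (QSpace p N) :=
  ⨅ g, LinearMap.eqLocus (weylOp c (α g) (β g)) LinearMap.id

lemma mem_stabilizerCode {c : ZMod p} {α β : G →+ (Fin N → ZMod p)} {v : QSpace p N} :
    v ∈ stabilizerCode c α β ↔ ∀ g, weylOp c (α g) (β g) v = v := by
  simp [stabilizerCode, Submodule.mem_iInf, LinearMap.mem_eqLocus]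

/-- The group average is a projection onto the code, so its trace is the dimension; only elements
with zero label contribute. Keeping just `g = 0` gives an inequality that needs no injectivity of
the labelling. -/
lemma pow_le_finrank_stabilizerCode_mul_card [Fintype G] {c : ZMod p} (hc : c + c = 1)
    {α β : G →+ (Fin N → ZMod p)} (h : ∀ g g', α g ⬝ᵥ β g' = β g ⬝ᵥ α g') :
    p ^ N ≤ Fintype.card G * Module.finrank ℂ (stabilizerCode c α β) := by
  have hG : (Fintype.card G : ℂ) ≠ 0 := by exact_mod_cast Fintype.card_ne_zero
  have hproj : LinearMap.IsProj (stabilizerCode c α β)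
      ((Fintype.card G : ℂ)⁻¹ • ∑ g, weylOp c (α g) (β g)) := by
    refine ⟨fun v => mem_stabilizerCode.2 fun g => ?_, fun v hv => ?_⟩
    · simp only [LinearMap.smul_apply, LinearMap.sum_apply, map_smul, map_sum]
      congr 1
      refine Fintype.sum_equiv (Equiv.addLeft g) _ _ fun g' => ?_
      rw [weylOp_weylOp hc (h g g'), Equiv.coe_addLeft, map_add, map_add]
    · rw [mem_stabilizerCode] at hv
      simp [LinearMap.smul_apply, LinearMap.sum_apply, hv, ← Nat.cast_smul_eq_nsmul ℂ, smul_smul,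
        hG]
  have htr := hproj.trace
  rw [map_smul, map_sum, smul_eq_mul, inv_mul_eq_iff_eq_mul₀ hG] at htr
  simp only [trace_weylOp] at htr
  have hnat : ∑ g, (if α g = 0 ∧ β g = 0 then p ^ N else 0) =
      Fintype.card G * Module.finrank ℂ (stabilizerCode c α β) := by
    exact_mod_cast htr
  rw [← hnat]
  calc p ^ N = if α 0 = 0 ∧ β 0 = 0 then p ^ N else 0 := by simp
    _ ≤ _ := single_le_sum (f := fun g => if α g = 0 ∧ β g = 0 then p ^ N else 0)
      (fun _ _ => Nat.zero_le _) (mem_univ 0)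

lemma weylOp_errorOp_comm (c : ZMod p) (a b a' b' : Fin N → ZMod p) (v : QSpace p N) :
    weylOp c a b (errorOp a' b' v) =
      (ZMod.stdAddChar (b ⬝ᵥ a' - b' ⬝ᵥ a) : ℂ) • errorOp a' b' (weylOp c a b v) := by
  rw [weylOp, LinearMap.smul_apply, LinearMap.smul_apply, errorOp_comm, map_smul, smul_comm]

lemma inner_weylOp_weylOp (c : ZMod p) (a b : Fin N → ZMod p) (v w : QSpace p N) :
    ⟪weylOp c a b v, weylOp c a b w⟫_ℂ = ⟪v, w⟫_ℂ := by
  rw [weylOp, LinearMap.smul_apply, LinearMap.smul_apply, inner_smul_left, inner_smul_right,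
    inner_errorOp_errorOp, ← mul_assoc]
  have := star_stdAddChar_mul_self (c * (a ⬝ᵥ b))
  rw [Complex.star_def] at this
  rw [this, one_mul]

lemma errorOp_mem_stabilizerCode {c : ZMod p} {α β : G →+ (Fin N → ZMod p)}
    {a b : Fin N → ZMod p} (h : ∀ g, β g ⬝ᵥ a = b ⬝ᵥ α g) {v : QSpace p N}
    (hv : v ∈ stabilizerCode c α β) : errorOp a b v ∈ stabilizerCode c α β := by
  rw [mem_stabilizerCode] at hv ⊢
  intro g
  rw [weylOp_errorOp_comm, hv g, h g, sub_self, AddChar.map_zero_eq_one, one_smul]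

/-- Applying the isometry of `g` to both arguments fixes `v` and `w` but multiplies the matrix
element by a phase different from `1`. -/
lemma inner_errorOp_eq_zero_of_mem_stabilizerCode {c : ZMod p} {α β : G →+ (Fin N → ZMod p)}
    {a b : Fin N → ZMod p} {g : G} (h : β g ⬝ᵥ a ≠ b ⬝ᵥ α g) {v w : QSpace p N}
    (hv : v ∈ stabilizerCode c α β) (hw : w ∈ stabilizerCode c α β) :
    ⟪v, errorOp a b w⟫_ℂ = 0 := by
  rw [mem_stabilizerCode] at hv hw
  have h1 : ⟪v, errorOp a b w⟫_ℂ =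
      ZMod.stdAddChar (β g ⬝ᵥ a - b ⬝ᵥ α g) * ⟪v, errorOp a b w⟫_ℂ := by
    conv_lhs => rw [← inner_weylOp_weylOp c (α g) (β g), weylOp_errorOp_comm, hv g, hw g]
    rw [inner_smul_right]
  by_contra h0
  have h2 : (ZMod.stdAddChar (β g ⬝ᵥ a - b ⬝ᵥ α g) : ℂ) = 1 := (mul_eq_right₀ h0).1 h1.symm
  rw [← AddChar.map_zero_eq_one (ZMod.stdAddChar (N := p))] at h2
  exact h (sub_eq_zero.1 (ZMod.injective_stdAddChar h2))

end Stabilizer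

/-- Cuts the stabilizer code down to dimension exactly `p ^ k` while keeping the vectors that
witness an undetected error. -/
lemma exists_submodule_between {K V : Type*} [Field K] [AddCommGroup V] [Module K V]
    [FiniteDimensional K V] {L Q : Submodule K V} (h : L ≤ Q) {d : ℕ}
    (hL : Module.finrank K L ≤ d) (hQ : d ≤ Module.finrank K Q) :
    ∃ M : Submodule K V, L ≤ M ∧ M ≤ Q ∧ Module.finrank K M = d := by
  induction d, hL using Nat.le_induction with
  | base => exact ⟨L, le_rfl, h, rfl⟩
  | succ d _ ih =>
    obtain ⟨M, hLM, hMQ, hM⟩ := ih (by omega)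
    have hlt : M < Q := lt_of_le_of_ne hMQ (by rintro rfl; omega)
    obtain ⟨x, hxQ, hxM⟩ := SetLike.exists_of_lt hlt
    refine ⟨M ⊔ Submodule.span K {x}, hLM.trans le_sup_left, sup_le hMQ ?_, ?_⟩
    · rwa [Submodule.span_singleton_le_iff_mem]
    · rw [Submodule.finrank_sup_span_singleton hxM, hM]

/-! ### From a stabilizer to a pure code of exact distance three. -/

section Stabilizer

variable {p N : ℕ} [NeZero p] {G : Type*} [AddCommGroup G]

/-- A code does not detect an error that acts inside it on a vector and on the image of this vector
under a second error, if the two errors do not commute. -/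
lemma not_detects_of_noncommuting {Q : Submodule ℂ (QSpace p N)} {a b a' b' : Fin N → ZMod p}
    (h : b ⬝ᵥ a' ≠ b' ⬝ᵥ a) {w : QSpace p N} (hw0 : w ≠ 0) (hw : w ∈ Q)
    (h1 : errorOp a b w ∈ Q) (h2 : errorOp a' b' w ∈ Q)
    (h3 : errorOp a b (errorOp a' b' w) ∈ Q) : ¬ Detects Q a b := by
  rintro ⟨c, hc⟩
  -- By the detection condition the difference of the two sides is orthogonal to `Q`, and it lies in
  -- `Q`. Noncommuting errors then contradict a common eigenvalue on `w` and its image.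
  have heig : ∀ u ∈ Q, errorOp a b u ∈ Q → errorOp a b u = c • u := fun u hu hu' => by
    rw [← sub_eq_zero, ← inner_self_eq_zero (𝕜 := ℂ)]
    conv_lhs => rw [inner_sub_right, hc _ (Q.sub_mem hu' (Q.smul_mem c hu)) _ hu,
      inner_smul_right, sub_self]
  have e1 := heig w hw h1
  have e2 := heig _ h2 h3
  have hc0 : c ≠ 0 := by
    rintro rfl
    exact errorOp_ne_zero a b hw0 (by rw [e1, zero_smul])
  rw [errorOp_comm, e1, map_smul, smul_smul] at e2
  have e3 := smul_left_injective ℂ (errorOp_ne_zero a' b' hw0) e2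
  have e4 : (ZMod.stdAddChar (b ⬝ᵥ a' - b' ⬝ᵥ a) : ℂ) = 1 := (mul_eq_right₀ hc0).1 e3
  rw [← AddChar.map_zero_eq_one (ZMod.stdAddChar (N := p))] at e4
  exact h (sub_eq_zero.1 (ZMod.injective_stdAddChar e4))

lemma detects_zero (Q : Submodule ℂ (QSpace p N)) : Detects Q 0 0 :=
  ⟨1, fun v _ w _ => by rw [errorOp_zero, one_mul]⟩

omit [NeZero p] in
lemma eq_zero_of_errorWeight_eq_zero {a b : Fin N → ZMod p} (h : errorWeight a b = 0) :
    a = 0 ∧ b = 0 := by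
  rw [errorWeight, card_eq_zero, filter_eq_empty_iff] at h
  constructor <;> ext i <;> have := h (mem_univ i) <;> push Not at this
  exacts [this.1, this.2]

/-- A stabilizer of order `p ^ m` whose normalizer has minimum weight `3`, the minimum being
attained by an error that does not commute with another element of the normalizer, gives a pure
code of distance `3`. -/
theorem exists_pure_code_of_stabilizer [Fintype G] {k m : ℕ} (hN : N = k + m)
    (hG : Fintype.card G = p ^ m) (hk : 4 ≤ p ^ k) {c : ZMod p} (hc : c + c = 1)
    {α β : G →+ (Fin N → ZMod p)} (hiso : ∀ g g', α g ⬝ᵥ β g' = β g ⬝ᵥ α g')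
    (hdist : ∀ a b : Fin N → ZMod p, 1 ≤ errorWeight a b → errorWeight a b ≤ 2 →
      ∃ g, β g ⬝ᵥ a ≠ b ⬝ᵥ α g)
    {a b a' b' : Fin N → ZMod p} (hwt : errorWeight a b = 3)
    (hab : ∀ g, β g ⬝ᵥ a = b ⬝ᵥ α g) (hab' : ∀ g, β g ⬝ᵥ a' = b' ⬝ᵥ α g)
    (hne : b ⬝ᵥ a' ≠ b' ⬝ᵥ a) :
    ∃ Q : Submodule ℂ (QSpace p N), IsQuantumCode p N k 3 Q ∧ IsPure Q 3 := by
  set S := stabilizerCode c α β with hS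
  have hdim : p ^ k ≤ Module.finrank ℂ S := by
    have h := pow_le_finrank_stabilizerCode_mul_card hc hiso
    rw [hG, show p ^ N = p ^ m * p ^ k by rw [← pow_add, hN, add_comm]] at h
    exact Nat.le_of_mul_le_mul_left h (pow_pos (NeZero.pos p) m)
  have hbot : S ≠ ⊥ := fun h0 => by
    rw [h0, finrank_bot] at hdim
    omega
  obtain ⟨w, hwS, hw0⟩ := S.exists_mem_ne_zero_of_ne_bot hbot
  set L : Submodule ℂ (QSpace p N) := Submodule.span ℂ (Set.range
    ![w, errorOp a b w, errorOp a' b' w, errorOp a b (errorOp a' b' w)]) with hL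
  have hLS : L ≤ S := by
    rw [hL, Submodule.span_le]
    rintro _ ⟨i, rfl⟩
    fin_cases i
    · exact hwS
    · exact errorOp_mem_stabilizerCode hab hwS
    · exact errorOp_mem_stabilizerCode hab' hwS
    · exact errorOp_mem_stabilizerCode hab (errorOp_mem_stabilizerCode hab' hwS)
  have hLdim : Module.finrank ℂ L ≤ p ^ k :=
    (finrank_range_le_card (R := ℂ) _).trans (by simpa using hk)
  obtain ⟨Q, hLQ, hQS, hQ⟩ := exists_submodule_between hLS hLdim hdim
  have hmem : ∀ i, ![w, errorOp a b w, errorOp a' b' w, errorOp a b (errorOp a' b' w)] i ∈ Q :=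
    fun i => hLQ (Submodule.subset_span ⟨i, rfl⟩)
  have hpure : IsPure Q 3 := fun x y h1 h2 v hv u hu => by
    obtain ⟨g, hg⟩ := hdist x y h1 h2
    exact inner_errorOp_eq_zero_of_mem_stabilizerCode hg (hQS hv) (hQS hu)
  refine ⟨Q, ⟨hQ, ⟨a, b, hwt, not_detects_of_noncommuting hne hw0 (hmem 0) (hmem 1) (hmem 2)
    (hmem 3)⟩, ?_⟩, hpure⟩
  rintro _ ⟨x, y, rfl, hxy⟩
  by_contra! hlt
  rcases Nat.eq_zero_or_pos (errorWeight x y) with h0 | h0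
  · obtain ⟨rfl, rfl⟩ := eq_zero_of_errorWeight_eq_zero h0
    exact hxy (detects_zero Q)
  · exact hxy ⟨0, fun v hv u hu => by rw [hpure x y h0 (by omega) v hv u hu, zero_mul]⟩

end Stabilizer

/-! ### Stabilizers from point sets in a vector space. -/

section Points

variable {p N : ℕ} [Fact p.Prime] {V : Type*} [AddCommGroup V] [Module (ZMod p) V]

/-- The word obtained by evaluating an affine function at given points. -/
def affineWord (t : Fin N → V) :
    (ZMod p × Module.Dual (ZMod p) V) →+ (Fin N → ZMod p) where
  toFun f i := f.1 + f.2 (t i)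
  map_zero' := by ext; simp
  map_add' f g := by
    ext i
    simp only [Prod.fst_add, Prod.snd_add, LinearMap.add_apply, Pi.add_apply]
    ring

lemma affineWord_dotProduct (t : Fin N → V) (f : ZMod p × Module.Dual (ZMod p) V)
    (a : Fin N → ZMod p) :
    affineWord t f ⬝ᵥ a = f.1 * ∑ i, a i + f.2 (∑ i, a i • t i) := by
  simp only [affineWord, AddMonoidHom.coe_mk, ZeroHom.coe_mk, dotProduct, add_mul,
    sum_add_distrib, map_sum, map_smul, smul_eq_mul, mul_sum]
  congr 1
  exact sum_congr rfl fun i _ => mul_comm _ _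

/-- First components of the stabilizer labels attached to a set of points. -/
def stabX (t : Fin N → V) :
    (ZMod p × ZMod p × Module.Dual (ZMod p) V) →+ (Fin N → ZMod p) :=
  (affineWord t).comp ((AddMonoidHom.fst _ _).prod
    ((AddMonoidHom.snd _ _).comp (AddMonoidHom.snd _ _)))

/-- Second components of the stabilizer labels attached to a set of points and an endomorphism. -/
def stabZ (A : V →ₗ[ZMod p] V) (t : Fin N → V) :
    (ZMod p × ZMod p × Module.Dual (ZMod p) V) →+ (Fin N → ZMod p) :=
  (affineWord fun i => A (t i)).comp (AddMonoidHom.snd _ _)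

lemma stabX_apply (t : Fin N → V) (g : ZMod p × ZMod p × Module.Dual (ZMod p) V) :
    stabX t g = affineWord t (g.1, g.2.2) := rfl

lemma stabZ_apply (A : V →ₗ[ZMod p] V) (t : Fin N → V)
    (g : ZMod p × ZMod p × Module.Dual (ZMod p) V) :
    stabZ A t g = affineWord (fun i => A (t i)) g.2 := rfl

/-- Moving `A` onto the functional shows that the Z-parts are again affine words at the same points,
so isotropy only needs the affine words to be mutually orthogonal. -/
lemma stabZ_apply_eq (A : V →ₗ[ZMod p] V) (t : Fin N → V)
    (g : ZMod p × ZMod p × Module.Dual (ZMod p) V) :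
    stabZ A t g = affineWord t (g.2.1, g.2.2.comp A) := rfl

/-- Points at which products of affine functions sum to zero, for an endomorphism without
eigenvectors, give a stabilizer whose normalizer has no elements of weight one or two. -/
lemma exists_stab_dotProduct_ne {t : Fin N → V} (ht : Function.Injective t)
    {A : V →ₗ[ZMod p] V} (hA : ∀ (v : V) (x y : ZMod p), v ≠ 0 → x • A v = y • v → x = 0)
    {a b : Fin N → ZMod p} (h1 : 1 ≤ errorWeight a b) (h2 : errorWeight a b ≤ 2) :
    ∃ g, stabZ A t g ⬝ᵥ a ≠ b ⬝ᵥ stabX t g := by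
  by_contra! h
  have h' : ∀ (c d : ZMod p) (f : Module.Dual (ZMod p) V),
      d * ∑ i, a i + f (∑ i, a i • A (t i)) = c * ∑ i, b i + f (∑ i, b i • t i) :=
    fun c d f => by
      have := h (c, d, f)
      rwa [dotProduct_comm b, stabZ_apply, stabX_apply, affineWord_dotProduct,
        affineWord_dotProduct] at this
  have ha : ∑ i, a i = 0 := by simpa using h' 0 1 0
  have hb : ∑ i, b i = 0 := by simpa using (h' 1 0 0).symm
  have hab : ∑ i, a i • A (t i) = ∑ i, b i • t i := by
    rw [← sub_eq_zero, ← Module.forall_dual_apply_eq_zero_iff (ZMod p)]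
    intro f
    rw [map_sub, sub_eq_zero]
    simpa using h' 0 0 f
  set s := univ.filter fun i => a i ≠ 0 ∨ b i ≠ 0 with hs
  have hsc : #s = errorWeight a b := rfl
  have hout : ∀ i, i ∉ s → a i = 0 ∧ b i = 0 := fun i hi => by
    simpa [hs, not_or] using hi
  have has : ∑ i ∈ s, a i = 0 :=
    (sum_subset (subset_univ s) fun i _ hi => (hout i hi).1).trans ha
  have hbs : ∑ i ∈ s, b i = 0 :=
    (sum_subset (subset_univ s) fun i _ hi => (hout i hi).2).trans hb
  have habs : ∑ i ∈ s, a i • A (t i) = ∑ i ∈ s, b i • t i := by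
    rw [sum_subset (subset_univ s) fun i _ hi => by rw [(hout i hi).1, zero_smul],
      sum_subset (subset_univ s) fun i _ hi => by rw [(hout i hi).2, zero_smul], hab]
  have hin : ∀ i ∈ s, ¬ (a i = 0 ∧ b i = 0) := fun i hi => by
    have := (mem_filter.1 hi).2
    tauto
  obtain hs1 | hs2 : #s = 1 ∨ #s = 2 := by omega
  · obtain ⟨i, hi⟩ := card_eq_one.1 hs1
    rw [hi, sum_singleton] at has hbs
    exact hin i (by simp [hi]) ⟨has, hbs⟩
  · obtain ⟨i, j, hij, hi⟩ := card_eq_two.1 hs2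
    rw [hi, sum_pair hij] at has hbs
    rw [hi, sum_pair hij, sum_pair hij] at habs
    have haj : a j = -a i := by linear_combination has
    have hbj : b j = -b i := by linear_combination hbs
    have hv : t i - t j ≠ 0 := sub_ne_zero.2 (ht.ne hij)
    have heq : a i • A (t i - t j) = b i • (t i - t j) := by
      rw [haj, hbj] at habs
      rw [map_sub, smul_sub, smul_sub]
      simpa [sub_eq_add_neg] using habs
    have h0 := hA _ _ _ hv heq
    rw [h0, zero_smul, eq_comm, smul_eq_zero_iff_left hv] at heq
    exact hin i (by simp [hi]) ⟨h0, heq⟩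

/-- A code from a set of points, a linear dependency of weight `3` among them, and another linear
dependency that is not orthogonal to it. -/
theorem exists_pure_code_of_points [Fintype V] (hp : p ≠ 2) {n k : ℕ}
    (hn : Module.finrank (ZMod p) V = n) (hN : N = k + (n + 2)) (hk : 4 ≤ p ^ k)
    {A : V →ₗ[ZMod p] V} (hA : ∀ (v : V) (x y : ZMod p), v ≠ 0 → x • A v = y • v → x = 0)
    {t : Fin N → V} (ht : Function.Injective t)
    (hsum : ∀ f g : ZMod p × Module.Dual (ZMod p) V, affineWord t f ⬝ᵥ affineWord t g = 0)
    {a b : Fin N → ZMod p} (hwt : #{i | a i ≠ 0} = 3)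
    (ha : ∑ i, a i = 0) (hat : ∑ i, a i • t i = 0)
    (hb : ∑ i, b i = 0) (hbt : ∑ i, b i • t i = 0) (hab : b ⬝ᵥ a ≠ 0) :
    ∃ Q : Submodule ℂ (QSpace p N), IsQuantumCode p N k 3 Q ∧ IsPure Q 3 := by
  have : Finite (Module.Dual (ZMod p) V) := Module.finite_of_finite (ZMod p)
  have : Fintype (Module.Dual (ZMod p) V) := Fintype.ofFinite _
  have hcard : Fintype.card (ZMod p × ZMod p × Module.Dual (ZMod p) V) = p ^ (n + 2) := by
    rw [Fintype.card_prod, Fintype.card_prod, Module.card_eq_pow_finrank (K := ZMod p)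
      (V := Module.Dual (ZMod p) V), Subspace.dual_finrank_eq, hn, ZMod.card]
    ring
  have h2 : (2 : ZMod p) ≠ 0 := by
    intro h
    have : ((2 : ℕ) : ZMod p) = 0 := by exact_mod_cast h
    rw [ZMod.natCast_eq_zero_iff] at this
    exact hp ((Nat.prime_dvd_prime_iff_eq Fact.out Nat.prime_two).1 this)
  -- The weight three error is purely of X type and its noncommuting partner purely of Z type; an
  -- affine dependency among the points puts either in the normalizer.
  refine exists_pure_code_of_stabilizer (c := (2 : ZMod p)⁻¹) (α := stabX t) (β := stabZ A t)
    (a := a) (b := 0) (a' := 0) (b' := b) hN hcard hk ?_ ?_ ?_ ?_ ?_ ?_ ?_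
  · rw [← two_mul, mul_inv_cancel₀ h2]
  · intro g g'
    rw [stabZ_apply_eq, stabZ_apply_eq, stabX_apply, stabX_apply, hsum, hsum]
  · exact fun a b h1 h2 => exists_stab_dotProduct_ne ht hA h1 h2
  · simpa [errorWeight] using hwt
  · intro g
    rw [zero_dotProduct, stabZ_apply_eq, affineWord_dotProduct, ha, hat]
    simp
  · intro g
    rw [dotProduct_zero, dotProduct_comm, stabX_apply, affineWord_dotProduct, hb, hbt]
    simp
  · rw [zero_dotProduct]
    exact hab.symm

end Points

section Endomorphism

/-- Identify `V` with the field of `p ^ n` elements and multiply by an element outside the prime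
field. -/
lemma exists_endomorphism_without_eigenvector (p : ℕ) [Fact p.Prime] {V : Type*} [AddCommGroup V]
    [Module (ZMod p) V] [FiniteDimensional (ZMod p) V] (hV : 2 ≤ Module.finrank (ZMod p) V) :
    ∃ A : V →ₗ[ZMod p] V, ∀ (v : V) (x y : ZMod p), v ≠ 0 → x • A v = y • v → x = 0 := by
  set n := Module.finrank (ZMod p) V with hn
  have hn0 : n ≠ 0 := by omega
  let e : V ≃ₗ[ZMod p] GaloisField p n :=
    LinearEquiv.ofFinrankEq _ _ (by rw [GaloisField.finrank p hn0])
  obtain ⟨θ, hθ⟩ : ∃ θ : GaloisField p n, θ ∉ Set.range (algebraMap (ZMod p) (GaloisField p n)) := by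
    by_contra! h
    have h1 := Nat.card_le_card_of_surjective _ (fun θ => h θ)
    rw [GaloisField.card p n hn0, Nat.card_zmod] at h1
    have h2 : p ^ 1 < p ^ n := Nat.pow_lt_pow_right (Fact.out : p.Prime).one_lt (by omega)
    rw [pow_one] at h2
    omega
  refine ⟨e.symm.toLinearMap ∘ₗ LinearMap.mulLeft (ZMod p) θ ∘ₗ e.toLinearMap,
    fun v x y hv h => ?_⟩
  by_contra hx
  have h' := congrArg e h
  simp only [map_smul, LinearMap.comp_apply, LinearEquiv.coe_coe, LinearEquiv.apply_symm_apply,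
    LinearMap.mulLeft_apply] at h'
  rw [Algebra.smul_def, Algebra.smul_def, ← mul_assoc] at h'
  have h2 := mul_right_cancel₀ (e.map_ne_zero_iff.2 hv) h'
  refine hθ ⟨x⁻¹ * y, ?_⟩
  rw [map_mul, ← h2, ← mul_assoc, ← map_mul, inv_mul_cancel₀ hx, map_one, one_mul]

end Endomorphism

section Moments

variable {p : ℕ} [Fact p.Prime]

/-- The lemma behind Chevalley–Warning: a polynomial of degree below `(p - 1) m` sums to zero over
`𝔽_p ^ m`. -/
lemma sum_affine_mul_affine {m : ℕ} (hm : 2 < (p - 1) * m)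
    (f g : Module.Dual (ZMod p) (Fin m → ZMod p)) (x y : ZMod p) :
    ∑ u, (x + f u) * (y + g u) = 0 := by
  have hlin : ∀ (h : Module.Dual (ZMod p) (Fin m → ZMod p)) (z : ZMod p),
      ∃ P : MvPolynomial (Fin m) (ZMod p), P.totalDegree ≤ 1 ∧
        ∀ u, MvPolynomial.eval u P = z + h u := by
    intro h z
    refine ⟨MvPolynomial.C z + ∑ i, MvPolynomial.C (h (Pi.single i 1)) * MvPolynomial.X i, ?_,
      fun u => ?_⟩
    · refine (MvPolynomial.totalDegree_add _ _).trans (max_le (by simp) ?_)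
      refine MvPolynomial.totalDegree_finsetSum_le fun i _ => ?_
      refine (MvPolynomial.totalDegree_mul _ _).trans ?_
      simp
    · conv_rhs => rw [LinearMap.pi_apply_eq_sum_univ h u]
      simp only [map_add, MvPolynomial.eval_C, map_sum, map_mul, MvPolynomial.eval_X,
        smul_eq_mul]
      congr 1
      refine sum_congr rfl fun i _ => ?_
      rw [mul_comm]
      congr 2
      ext j
      simp [Pi.single_apply, eq_comm]
  obtain ⟨P, hP, hP'⟩ := hlin f x
  obtain ⟨R, hR, hR'⟩ := hlin g y
  simp only [← hP', ← hR', ← map_mul]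
  refine MvPolynomial.sum_eval_eq_zero _ ?_
  rw [ZMod.card, Fintype.card_fin]
  exact ((MvPolynomial.totalDegree_mul _ _).trans (add_le_add hP hR)).trans_lt hm

end Moments

/-! ### Weight three words on arithmetic progressions. -/

section LineWord

variable {p N : ℕ}

/-- The second difference word supported on three points of an arithmetic progression. -/
def lineWord (p : ℕ) (i j l : Fin N) : Fin N → ZMod p :=
  Pi.single i 1 + Pi.single l 1 - Pi.single j 2

lemma sum_lineWord (i j l : Fin N) : ∑ x, lineWord p i j l x = 0 := by
  simp only [lineWord, Pi.sub_apply, Pi.add_apply, sum_sub_distrib, sum_add_distrib,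
    Finset.sum_pi_single', mem_univ, if_true]
  ring

lemma sum_lineWord_smul {V : Type*} [AddCommGroup V] [Module (ZMod p) V] {t : Fin N → V}
    {i j l : Fin N} (h : t i + t l = (2 : ZMod p) • t j) :
    ∑ x, lineWord p i j l x • t x = 0 := by
  simp only [lineWord, Pi.sub_apply, Pi.add_apply, sub_smul, add_smul, sum_sub_distrib,
    sum_add_distrib]
  have hs : ∀ (k : Fin N) (z : ZMod p), ∑ x, (Pi.single k z : Fin N → ZMod p) x • t x = z • t k :=
    fun k z => by
      rw [Fintype.sum_eq_single k fun x hx => by rw [Pi.single_eq_of_ne hx, zero_smul],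
        Pi.single_eq_same]
  rw [hs, hs, hs, one_smul, one_smul, h, sub_self]

lemma card_support_lineWord (h2 : (2 : ZMod p) ≠ 0) {i j l : Fin N} (hij : i ≠ j)
    (hil : i ≠ l) (hjl : j ≠ l) : #{x | lineWord p i j l x ≠ 0} = 3 := by
  have h1 : (1 : ZMod p) ≠ 0 := fun h => h2 (by rw [← one_add_one_eq_two, h, add_zero])
  rw [card_eq_three]
  refine ⟨i, j, l, hij, hil, hjl, ?_⟩
  ext x
  rw [mem_filter]
  rcases eq_or_ne x i with rfl | hxi
  · simp [lineWord, hij, hil, h1]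
  rcases eq_or_ne x j with rfl | hxj
  · simp [lineWord, hxi, hjl, h2]
  rcases eq_or_ne x l with rfl | hxl
  · simp [lineWord, hxi, hxj, h1]
  · simp [lineWord, hxi, hxj, hxl]

lemma lineWord_dotProduct_self {i j l : Fin N} (hij : i ≠ j)
    (hil : i ≠ l) (hjl : j ≠ l) : lineWord p i j l ⬝ᵥ lineWord p i j l = 6 := by
  conv_lhs => arg 1; rw [lineWord]
  simp only [sub_dotProduct, add_dotProduct, single_dotProduct, lineWord]
  simp [hij, hil, hjl, hij.symm, hil.symm, hjl.symm]
  norm_num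

/-- Serves `p = 3`, where a line word is orthogonal to itself because `6 = 0`: two lines meeting
only in their first point are used instead. -/
lemma lineWord_dotProduct_of_ne {i j l j' l' : Fin N} (hij : i ≠ j) (hil : i ≠ l) (hij' : i ≠ j')
    (hil' : i ≠ l') (hjj : j ≠ j') (hjl : j ≠ l') (hlj : l ≠ j') (hll : l ≠ l') :
    lineWord p i j' l' ⬝ᵥ lineWord p i j l = 1 := by
  conv_lhs => arg 1; rw [lineWord]
  simp only [sub_dotProduct, add_dotProduct, single_dotProduct, lineWord]
  simp [hij, hil, hij'.symm, hil'.symm, hjj.symm, hjl.symm, hlj.symm, hll.symm]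

end LineWord

/-! ### Unions of parallel affine subspaces, and the choice of parameters. -/

section Main

variable {p : ℕ} [Fact p.Prime]

lemma natCast_ne_zero_of_not_dvd {a : ℕ} (h : ¬ p ∣ a) : ((a : ℕ) : ZMod p) ≠ 0 := by
  rwa [Ne, ZMod.natCast_eq_zero_iff]

/-- A pure code from a union of `r` parallel affine subspaces of dimension `m`. -/
theorem exists_pure_code_of_cosets {m c r k N : ℕ} (hpm : 5 ≤ p ∧ 1 ≤ m ∨ p = 3 ∧ 2 ≤ m)
    (hc : 2 ≤ c) (hr0 : 0 < r) (hr : r ≤ p ^ c) (hN : N = p ^ m * r)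
    (hk : N = k + (m + c + 2)) (hk4 : 4 ≤ p ^ k) :
    ∃ Q : Submodule ℂ (QSpace p N), IsQuantumCode p N k 3 Q ∧ IsPure Q 3 := by
  obtain ⟨R, -, hR⟩ := exists_subset_card_eq (s := (univ : Finset (Fin c → ZMod p))) (n := r)
    (by simpa [ZMod.card] using hr)
  obtain ⟨r₀, hr₀⟩ := card_pos.1 (hR ▸ hr0)
  set T : Finset ((Fin m → ZMod p) × (Fin c → ZMod p)) := univ ×ˢ R with hT
  have hTc : #T = N := by
    rw [hT, card_product, hR, hN, card_univ, Fintype.card_fun, ZMod.card, Fintype.card_fin]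
  let e := T.equivFinOfCardEq hTc
  set t : Fin N → (Fin m → ZMod p) × (Fin c → ZMod p) := fun i => (e.symm i).1 with ht
  have htinj : Function.Injective t := Subtype.val_injective.comp e.symm.injective
  have hfin : Module.finrank (ZMod p) ((Fin m → ZMod p) × (Fin c → ZMod p)) = m + c := by simp
  obtain ⟨A, hA⟩ := exists_endomorphism_without_eigenvector p
    (V := (Fin m → ZMod p) × (Fin c → ZMod p)) (by omega)
  have hp2 : p ≠ 2 := by rcases hpm with h | h <;> omega
  have hm2 : 2 < (p - 1) * m := by
    rcases hpm with ⟨h, h'⟩ | ⟨h, h'⟩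
    · calc 2 < 4 * 1 := by norm_num
        _ ≤ (p - 1) * m := Nat.mul_le_mul (by omega) h'
    · subst h
      omega
  have h2 : (2 : ZMod p) ≠ 0 := by
    have := natCast_ne_zero_of_not_dvd (p := p) (a := 2) fun h =>
      hp2 ((Nat.prime_dvd_prime_iff_eq Fact.out Nat.prime_two).1 h)
    exact_mod_cast this
  have hsum : ∀ f g : ZMod p × Module.Dual (ZMod p) ((Fin m → ZMod p) × (Fin c → ZMod p)),
      affineWord t f ⬝ᵥ affineWord t g = 0 := by
    intro f g
    set F : (Fin m → ZMod p) × (Fin c → ZMod p) → ZMod p :=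
      fun v => (f.1 + f.2 v) * (g.1 + g.2 v) with hF
    have h1 : affineWord t f ⬝ᵥ affineWord t g = ∑ v ∈ T, F v := by
      rw [← sum_coe_sort T F]
      exact Fintype.sum_equiv e.symm _ _ fun i => rfl
    rw [h1, hT, sum_product_right]
    refine sum_eq_zero fun x _ => ?_
    have hsplit : ∀ (h : Module.Dual (ZMod p) ((Fin m → ZMod p) × (Fin c → ZMod p)))
        (u : Fin m → ZMod p), h (u, x) = h (0, x) + (h ∘ₗ LinearMap.inl _ _ _) u := by
      intro h u
      rw [LinearMap.comp_apply, LinearMap.inl_apply, ← map_add]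
      simp
    have hF' : ∀ u, F (u, x) = (f.1 + f.2 (0, x) + (f.2 ∘ₗ LinearMap.inl _ _ _) u) *
        (g.1 + g.2 (0, x) + (g.2 ∘ₗ LinearMap.inl _ _ _) u) := fun u => by
      rw [add_assoc, add_assoc, ← hsplit, ← hsplit]
    rw [sum_congr rfl fun u _ => hF' u]
    exact sum_affine_mul_affine hm2 _ _ _ _
  let P : (Fin m → ZMod p) → Fin N := fun u => e ⟨(u, r₀), by simp [hT, hr₀]⟩
  have hP : ∀ u, t (P u) = (u, r₀) := fun u => by simp [ht, P]
  have hPinj : ∀ {u v}, u ≠ v → P u ≠ P v := fun {u v} h h' => h (by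
    have := hP u
    rw [h', hP v] at this
    exact (congrArg Prod.fst this).symm)
  have hline : ∀ v : Fin m → ZMod p,
      t (P 0) + t (P ((2 : ZMod p) • v)) = (2 : ZMod p) • t (P v) := fun v => by
    simp only [hP]
    ext : 1
    · simp
    · simp [two_smul]
  let v : Fin m → ZMod p := Pi.single ⟨0, by rcases hpm with h | h <;> omega⟩ 1
  have hv0 : v ≠ 0 := by simp [v]
  have hne1 : ∀ w : Fin m → ZMod p, w ≠ 0 → (0 : Fin m → ZMod p) ≠ w := fun w hw => hw.symm
  have hne2 : ∀ w : Fin m → ZMod p, w ≠ 0 → (0 : Fin m → ZMod p) ≠ (2 : ZMod p) • w :=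
    fun w hw => (smul_ne_zero h2 hw).symm
  have hne3 : ∀ w : Fin m → ZMod p, w ≠ 0 → w ≠ (2 : ZMod p) • w := fun w hw h => by
    rw [two_smul] at h
    exact hw (by simpa using h)
  have hi01 := hPinj (hne1 v hv0)
  have hi02 := hPinj (hne2 v hv0)
  have hi12 := hPinj (hne3 v hv0)
  -- For `p ≥ 5` one word serves for both errors, as `6` is invertible. For `p = 3` a second
  -- direction `w` is needed, available since `m ≥ 2`.
  rcases hpm with ⟨hp5, hm⟩ | ⟨hp3, hm⟩
  · refine exists_pure_code_of_points hp2 hfin hk hk4 hA htinj hsum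
      (card_support_lineWord h2 hi01 hi02 hi12) (sum_lineWord _ _ _) (sum_lineWord_smul (hline v))
      (sum_lineWord _ _ _) (sum_lineWord_smul (hline v)) ?_
    rw [lineWord_dotProduct_self hi01 hi02 hi12]
    have := natCast_ne_zero_of_not_dvd (p := p) (a := 6) fun h => by
      have h6 := Nat.le_of_dvd (by norm_num) h
      have hpr : p.Prime := Fact.out
      interval_cases p
      · omega
      · exact absurd hpr (by norm_num)
    exact_mod_cast this
  · let w : Fin m → ZMod p := Pi.single ⟨1, by omega⟩ 1
    have hw0 : w ≠ 0 := by simp [w]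
    have hcross : ∀ x y : ZMod p, x ≠ 0 → x • v ≠ y • w := fun x y hx h => by
      have := congrFun h ⟨0, by omega⟩
      simp [v, w] at this
      exact hx this
    refine exists_pure_code_of_points hp2 hfin hk hk4 hA htinj hsum
      (card_support_lineWord h2 hi01 hi02 hi12) (sum_lineWord _ _ _) (sum_lineWord_smul (hline v))
      (sum_lineWord _ _ _) (sum_lineWord_smul (hline w)) ?_
    rw [lineWord_dotProduct_of_ne hi01 hi02 (hPinj (hne1 w hw0)) (hPinj (hne2 w hw0))
      (hPinj (by simpa using hcross 1 1 one_ne_zero)) (hPinj (by simpa using hcross 1 2 one_ne_zero))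
      (hPinj (by simpa using hcross 2 1 h2)) (hPinj (hcross 2 2 h2))]
    exact one_ne_zero

theorem existsGoodPureCode_of_cosets {m c r N : ℕ} (hpm : 5 ≤ p ∧ 1 ≤ m ∨ p = 3 ∧ 2 ≤ m)
    (hc : 2 ≤ c) (hr0 : 0 < r) (hr : r ≤ p ^ c) (hN : N = p ^ m * r)
    (hlong : LongLength p (m + c) N) :
    ∃ k : ℕ, (k : ℤ) = (N : ℤ) - (m + c : ℕ) - 2 ∧ ExistsGoodPureCode p N k 3 := by
  have h4 := hlong.add_four_le
  obtain ⟨k, hk⟩ : ∃ k, N = k + (m + c + 2) := ⟨N - (m + c + 2), by omega⟩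
  refine ⟨k, by omega, exists_pure_code_of_cosets hpm hc hr0 hr hN hk ?_,
    hlong.optimal_or_almostOptimal hk, hlong.not_hammingBound hk⟩
  have hp2 : 2 ≤ p := (Fact.out : p.Prime).two_le
  calc 4 = 2 ^ 2 := rfl
    _ ≤ p ^ 2 := Nat.pow_le_pow_left hp2 2
    _ ≤ p ^ k := Nat.pow_le_pow_right (by omega) (by omega)

end Main

end QCode

theorem theorem9 (p : ℕ) [Fact p.Prime] (hp : p ≠ 2) (n s : ℕ) (hs : p = 3 → 1 ≤ s)
    (ε₀ : ℤ) (hε : ε₀ = 1 ∨ ε₀ = -1) :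
    (n = 4 + s → ∃ N k : ℕ,
      2 * (N : ℤ) = (p : ℤ) ^ (n - 1) - ε₀ * (p : ℤ) ^ (n - 3) ∧
      (k : ℤ) = (N : ℤ) - n - 2 ∧ QCode.ExistsGoodPureCode p N k 3) ∧
    (n = 3 + s → ∃ N k : ℕ,
      2 * (N : ℤ) = (p : ℤ) ^ (n - 1) + ε₀ * (p : ℤ) ^ (n - 2) ∧
      (k : ℤ) = (N : ℤ) - n - 2 ∧ QCode.ExistsGoodPureCode p N k 3) := by
  have hpr : p.Prime := Fact.out
  obtain ⟨h, hh⟩ : ∃ h, p = 2 * h + 1 := hpr.odd_of_ne_two hp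
  have hp35 : p = 3 ∨ 5 ≤ p := by
    have := hpr.two_le
    omega
  have hh1 : 1 ≤ h := by omega
  have hp1 : p - 1 = 2 * h := by omega
  have hpz : (p : ℤ) = 2 * h + 1 := by exact_mod_cast hh
  constructor
  · rintro rfl
    -- Here `m = s + 1`, `c = 3` and `r = (p ^ 2 - ε₀) / 2`; for `p = 3` the condition `1 ≤ s` is
    -- what gives `m ≥ 2`.
    obtain ⟨r, hr2, hr0, hr, hrl⟩ : ∃ r : ℕ, 2 * (r : ℤ) = (p : ℤ) ^ 2 - ε₀ ∧ 0 < r ∧ r ≤ p ^ 3 ∧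
        p * (p - 1) ≤ 2 * r := by
      rw [hp1]
      rcases hε with rfl | rfl
      · refine ⟨2 * h ^ 2 + 2 * h, ?_, by positivity, ?_, ?_⟩
        · rw [hpz]; push_cast; ring
        · rw [hh]; nlinarith [Nat.zero_le (h ^ 3)]
        · rw [hh]; nlinarith
      · refine ⟨2 * h ^ 2 + 2 * h + 1, ?_, by positivity, ?_, ?_⟩
        · rw [hpz]; push_cast; ring
        · rw [hh]; nlinarith [Nat.zero_le (h ^ 3)]
        · rw [hh]; nlinarith
    have hl : QCode.LongLength p (s + 1 + 3) (p ^ (s + 1) * r) := by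
      refine ⟨by rcases hp35 with h | h <;> omega, ?_⟩
      rw [show s + 1 + 3 - 2 = s + 1 + 1 by omega, pow_succ p (s + 1)]
      have := Nat.mul_le_mul_left (p ^ (s + 1)) hrl
      linarith
    obtain ⟨k, hk, hgood⟩ := QCode.existsGoodPureCode_of_cosets
      (by rcases hp35 with h | h <;> omega) (by norm_num) hr0 hr rfl hl
    refine ⟨_, k, ?_, ?_, hgood⟩
    · rw [show 4 + s - 1 = s + 1 + 2 by omega, show 4 + s - 3 = s + 1 by omega]
      push_cast
      linear_combination (p : ℤ) ^ (s + 1) * hr2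
    · rw [hk]; push_cast; ring
  · rintro rfl
    -- Here `m = s + 1`, `c = 2` and `r = (p + ε₀) / 2`.
    obtain ⟨r, hr2, hr0, hr, hrl⟩ : ∃ r : ℕ, 2 * (r : ℤ) = p + ε₀ ∧ 0 < r ∧ r ≤ p ^ 2 ∧
        p - 1 ≤ 2 * r := by
      rw [hp1]
      rcases hε with rfl | rfl
      · refine ⟨h + 1, ?_, by positivity, ?_, by omega⟩
        · rw [hpz]; push_cast; ring
        · rw [hh]; nlinarith
      · refine ⟨h, ?_, by positivity, ?_, by omega⟩
        · rw [hpz]; ring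
        · rw [hh]; nlinarith
    have hl : QCode.LongLength p (s + 1 + 2) (p ^ (s + 1) * r) := by
      refine ⟨by rcases hp35 with h | h <;> omega, ?_⟩
      rw [show s + 1 + 2 - 2 = s + 1 by omega]
      have := Nat.mul_le_mul_left (p ^ (s + 1)) hrl
      linarith
    obtain ⟨k, hk, hgood⟩ := QCode.existsGoodPureCode_of_cosets
      (by rcases hp35 with h | h <;> omega) (by norm_num) hr0 hr rfl hl
    refine ⟨_, k, ?_, ?_, hgood⟩
    · rw [show 3 + s - 1 = s + 1 + 1 by omega, show 3 + s - 2 = s + 1 by omega]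
      push_cast
      linear_combination (p : ℤ) ^ (s + 1) * hr2
    · rw [hk]; push_cast; ring
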